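/- Let $H\colon\mathbb C^n\times\mathbb C^n\to\mathbb C^k$ be a vector valued hermitian form (linear in the first and antilinear in the second variable, $H(z',z)=\overline{H(z,z')}$) that is nondegenerate (for every $z\neq0$ there is $z'$ with $H(z,z')\neq0$) and fundamental (the vectors $H(z,z)$ span $\mathbb R^k$). Let $\mathfrak g=\bigoplus_{p\in\mathbb Z}\mathfrak g_p$ be the associated Levi-Tanaka algebra. This is the graded real Lie algebra such that: $\mathfrak g_{-1}=\mathbb C^n$ with its complex structure $J$, $\mathfrak g_{-2}=\mathbb R^k$, $\mathfrak g_p=0$ for $p<-2$, and $[X,Y]=\operatorname{Im}H(X,Y)$ for $X,Y\in\mathfrak g_{-1}$; $\mathfrak g_0$ is the space of all derivations of degree $0$ of $\mathfrak g_{-1}\oplus\mathfrak g_{-2}$ that commute with $J$ on $\mathfrak g_{-1}$; for every nonzero $X\in\mathfrak g_p$ with $p\ge0$ the map $\operatorname{ad}(X)|_{\mathfrak g_{-1}}$ is nonzero; and $\mathfrak g$ is maximal with these properties. Let $E\in\mathfrak g_0$ be its characteristic element, i.e. $\operatorname{ad}(E)|_{\mathfrak g_j}=j\,\mathrm{Id}$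 for all $j\in\mathbb Z$. Let $\hat Q$ be the CR quadric associated to $H$, i.e. the homogeneous space of $\mathrm{Int}(\mathfrak g)$, the group generated by the $\exp(\operatorname{ad}X)$ with $X\in\mathfrak g$, by the subgroup generated by the $\exp(\operatorname{ad}X)$ with $X\in\mathfrak p=\bigoplus_{p\ge0}\mathfrak g_p$. It carries the $\mathrm{Int}(\mathfrak g)$-homogeneous CR structure that at the base point is given by $(\mathfrak g_{-1},J)$. Let $\mathfrak g=\mathfrak s\oplus\mathfrak r$ be a pseudocomplex graded Levi-Malcev decomposition: $\mathfrak r$ is the radical, $\mathfrak s$ is a semisimple subalgebra, $\mathfrak s$ and $\mathfrak r$ are graded, and $\mathfrak s\cap\mathfrak g_{-1}$ and $\mathfrak r\cap\mathfrak g_{-1}$ are $J$-invariant. Write $E=E_{\mathfrak s}+E_{\mathfrak r}$ with $E_{\mathfrak s}\in\mathfrak s$ and $E_{\mathfrak r}\in\mathfrak r$. Suppose that $\hat Q$ admits a CR automorphism $\gamma$ with $\mathrm{Ad}(\gamma)(E)=-E$, that is, $\gamma\circ\exp(tE)\circ\gamma^{-1}=\exp(-tE)$ on $\hat Q$ for all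 $t\in\mathbb R$. Then $E=E_{\mathfrak s}$; in particular $E\in\mathfrak s$. -/

import Mathlib

open scoped ContDiff Topology

universe u

namespace CRQuadric

/-! ### Vector valued hermitian forms -/

/-- A map `H : ℂⁿ × ℂⁿ → ℂᵏ`, linear in the first and antilinear in the second variable. -/
abbrev SesqForm (n k : ℕ) : Type :=
  (Fin n → ℂ) →ₗ[ℂ] (Fin n → ℂ) →ₛₗ[starRingEnd ℂ] (Fin k → ℂ)

variable {n k : ℕ}

def IsHermitianForm (H : SesqForm n k) : Prop :=
  ∀ z z' j, H z' z j = starRingEnd ℂ (H z z' j)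

def IsNondegenerate (H : SesqForm n k) : Prop :=
  ∀ z, z ≠ 0 → ∃ z', H z z' ≠ 0

/-- The vectors `H(z,z) ∈ ℝᵏ` span `ℝᵏ` (for a hermitian form, `H(z,z)` is real). -/
def IsFundamental (H : SesqForm n k) : Prop :=
  Submodule.span ℝ (Set.range fun (z : Fin n → ℂ) (j : Fin k) => (H z z j).re) = ⊤

/-- The bracket `ℂⁿ × ℂⁿ → ℝᵏ`, `(z, z') ↦ Im H(z, z')`. -/
def imForm (H : SesqForm n k) (z z' : Fin n → ℂ) : Fin k → ℝ :=
  fun j => (H z z' j).im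

/-! ### The Levi-Tanaka algebra associated to a hermitian form -/

section LeviTanaka

variable {g : Type u} [LieRing g] [LieAlgebra ℝ g]

/-- `𝔤 = ⨁ 𝔤_p` is a `ℤ`-graded real Lie algebra. -/
structure IsLieGrading (𝒜 : ℤ → Submodule ℝ g) : Prop where
  isInternal : DirectSum.IsInternal 𝒜
  lie_mem : ∀ {i j : ℤ} {X Y : g}, X ∈ 𝒜 i → Y ∈ 𝒜 j → ⁅X, Y⁆ ∈ 𝒜 (i + j)

/-- The part of nonpositive degree is the one determined by `H`.
The maps `i₁`, `i₂` identify `ℂⁿ` with `𝔤₋₁` and `ℝᵏ` with `𝔤₋₂`; the complex structure `J` on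
`𝔤₋₁` is multiplication by `i` on `ℂⁿ`; the bracket of `𝔤₋₁` is `Im H`; and `𝔤₀` is (through its
action) the space of all derivations of degree zero of `𝔤₋₂ ⊕ 𝔤₋₁` that commute with `J` on
`𝔤₋₁`.  Such a derivation is a pair `(A, B)` of a complex linear endomorphism of `ℂⁿ` and a real
linear endomorphism of `ℝᵏ` with `B (Im H(z,z')) = Im H(A z,z') + Im H(z,A z')`. -/
structure HasNonposPart (H : SesqForm n k) (𝒜 : ℤ → Submodule ℝ g)
    (i₁ : (Fin n → ℂ) →ₗ[ℝ] g) (i₂ : (Fin k → ℝ) →ₗ[ℝ] g) : Prop where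
  injective₁ : Function.Injective i₁
  range₁ : LinearMap.range i₁ = 𝒜 (-1)
  injective₂ : Function.Injective i₂
  range₂ : LinearMap.range i₂ = 𝒜 (-2)
  eq_bot : ∀ p : ℤ, p < -2 → 𝒜 p = ⊥
  bracket : ∀ z z', ⁅i₁ z, i₁ z'⁆ = i₂ (imForm H z z')
  zero_complexLinear : ∀ X ∈ 𝒜 0, ∃ A : (Fin n → ℂ) →ₗ[ℂ] (Fin n → ℂ),
    ∀ z, ⁅X, i₁ z⁆ = i₁ (A z)
  zero_all : ∀ (A : (Fin n → ℂ) →ₗ[ℂ] (Fin n → ℂ)) (B : (Fin k → ℝ) →ₗ[ℝ] (Fin k → ℝ)),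
    (∀ z z', B (imForm H z z') = imForm H (A z) z' + imForm H z (A z')) →
    ∃! X : g, X ∈ 𝒜 0 ∧ (∀ z, ⁅X, i₁ z⁆ = i₁ (A z)) ∧ ∀ w, ⁅X, i₂ w⁆ = i₂ (B w)

/-- For every nonzero `X ∈ 𝔤_p` with `p ≥ 0`, the map `ad X` is nonzero on `𝔤₋₁`. -/
def IsTransitive (𝒜 : ℤ → Submodule ℝ g) : Prop :=
  ∀ p : ℤ, 0 ≤ p → ∀ X ∈ 𝒜 p, X ≠ 0 → ∃ Y ∈ 𝒜 (-1), ⁅X, Y⁆ ≠ 0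

/-- `𝔤 = ⨁ 𝔤_p` is the Levi-Tanaka algebra of the quadric associated to `H`: its nonpositive part
is the one determined by `H`, it is transitive, and it is maximal, that is, it has no proper graded
extension with these properties. -/
structure IsLeviTanaka (H : SesqForm n k) (𝒜 : ℤ → Submodule ℝ g)
    (i₁ : (Fin n → ℂ) →ₗ[ℝ] g) (i₂ : (Fin k → ℝ) →ₗ[ℝ] g) : Prop where
  grading : IsLieGrading 𝒜
  nonpos : HasNonposPart H 𝒜 i₁ i₂
  transitive : IsTransitive 𝒜
  maximal : ∀ (g' : Type u) [LieRing g'] [LieAlgebra ℝ g'] (𝒜' : ℤ → Submodule ℝ g')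
    (f : g →ₗ⁅ℝ⁆ g'), Function.Injective f → (∀ p, ∀ X ∈ 𝒜 p, f X ∈ 𝒜' p) →
    IsLieGrading 𝒜' →
    HasNonposPart H 𝒜' ((f : g →ₗ[ℝ] g') ∘ₗ i₁) ((f : g →ₗ[ℝ] g') ∘ₗ i₂) →
    IsTransitive 𝒜' → Function.Surjective f

/-- `E ∈ 𝔤₀` and `ad E` is multiplication by `j` on `𝔤_j`. -/
def IsCharacteristicElement (𝒜 : ℤ → Submodule ℝ g) (E : g) : Prop :=
  E ∈ 𝒜 0 ∧ ∀ (j : ℤ), ∀ X ∈ 𝒜 j, ⁅E, X⁆ = (j : ℝ) • X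

/-- `𝔭 = ∑_{p ≥ 0} 𝔤_p`. -/
def parabolic (𝒜 : ℤ → Submodule ℝ g) : Submodule ℝ g :=
  ⨆ (p : ℤ) (_ : 0 ≤ p), 𝒜 p

/-- A pseudocomplex graded Levi-Malcev decomposition `𝔤 = 𝔰 ⊕ 𝔯`, with `𝔯` the radical: `𝔰` is a
semisimple subalgebra, `𝔰` and `𝔯` are graded, and `𝔰₋₁`, `𝔯₋₁` are `J`-invariant. -/
structure IsPseudocomplexGradedLevi (𝒜 : ℤ → Submodule ℝ g) (i₁ : (Fin n → ℂ) →ₗ[ℝ] g)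
    (s : LieSubalgebra ℝ g) : Prop where
  semisimple : LieAlgebra.IsSemisimple ℝ s
  isCompl : IsCompl s.toSubmodule (LieAlgebra.radical ℝ g).toSubmodule
  graded : s.toSubmodule = ⨆ p : ℤ, s.toSubmodule ⊓ 𝒜 p
  radical_graded : (LieAlgebra.radical ℝ g).toSubmodule =
    ⨆ p : ℤ, (LieAlgebra.radical ℝ g).toSubmodule ⊓ 𝒜 p
  J_mem : ∀ z, i₁ z ∈ s → i₁ (Complex.I • z) ∈ s
  radical_J_mem : ∀ z, i₁ z ∈ LieAlgebra.radical ℝ g →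
    i₁ (Complex.I • z) ∈ LieAlgebra.radical ℝ g

end LeviTanaka

/-! ### The group of inner automorphisms -/

section Inner

variable (g : Type u) [LieRing g] [LieAlgebra ℝ g]

variable {g} in
/-- `A = exp(ad X)`: the exponential series converges pointwise to `A`.  The module topology is the
usual topology when `𝔤` is finite dimensional. -/
def IsExpAd (X : g) (A : g ≃ₗ[ℝ] g) : Prop :=
  letI : TopologicalSpace g := moduleTopology ℝ g
  ∀ Y : g, HasSum (fun m : ℕ => ((m.factorial : ℝ)⁻¹) • ((LieAlgebra.ad ℝ g X) ^ m) Y) (A Y)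

/-- `Int(𝔤)`, the subgroup of `GL(𝔤)` generated by the `exp(ad X)`, `X ∈ 𝔤`. -/
def Int : Subgroup (g ≃ₗ[ℝ] g) :=
  Subgroup.closure {A | ∃ X : g, IsExpAd X A}

variable {g}

open Classical in
/-- `exp(ad X)` as an element of `Int(𝔤)`.  (It exists for every `X` when `𝔤` is finite
dimensional.) -/
noncomputable def expAd (X : g) : Int g :=
  if h : ∃ A : Int g, IsExpAd X (A : g ≃ₗ[ℝ] g) then h.choose else 1

/-- The analytic subgroup of `Int(𝔤)` with Lie algebra `𝔭`, that is, the subgroup generated by the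
`exp(ad X)`, `X ∈ 𝔭`. -/
def parabolicGroup (𝒜 : ℤ → Submodule ℝ g) : Subgroup (Int g) :=
  Subgroup.closure {A | ∃ X ∈ parabolic 𝒜, IsExpAd X (A : g ≃ₗ[ℝ] g)}

end Inner

/-! ### The quadric and its CR automorphisms -/

section Quadric

variable {g : Type u} [LieRing g] [LieAlgebra ℝ g]

/-- The quadric `Q̂` (the standard CR manifold of `𝔤`), a homogeneous space of `Int(𝔤)` with
isotropy algebra `𝔭` at the base point. -/
abbrev Quadric (𝒜 : ℤ → Submodule ℝ g) : Type u := Int g ⧸ parabolicGroup 𝒜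

/-- The parametrization `v ↦ a exp(v) · o` of a neighbourhood of the point `a · o` of `Q̂`, with
`v ∈ 𝔤₋ = 𝔤₋₁ ⊕ 𝔤₋₂`, which is identified with `ℂⁿ × ℝᵏ`. -/
noncomputable def chart (𝒜 : ℤ → Submodule ℝ g) (i₁ : (Fin n → ℂ) →ₗ[ℝ] g)
    (i₂ : (Fin k → ℝ) →ₗ[ℝ] g) (a : Int g) (v : (Fin n → ℂ) × (Fin k → ℝ)) : Quadric 𝒜 :=
  QuotientGroup.mk (a * expAd (i₁ v.1 + i₂ v.2))

/-- `φ : Q̂ → Q̂` is a smooth CR map.  The CR structure is the homogeneous one: at `a · o`, in the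
parametrization `chart a`, the bundle of complex tangent directions is `𝔤₋₁ = ℂⁿ` and its complex
structure is multiplication by `i`.  So in the parametrizations around `a · o` and around
`φ (a · o) = b · o`, the map `φ` is smooth and its differential at the origin maps `ℂⁿ` to `ℂⁿ`,
complex linearly. -/
def IsCRMap (𝒜 : ℤ → Submodule ℝ g) (i₁ : (Fin n → ℂ) →ₗ[ℝ] g) (i₂ : (Fin k → ℝ) →ₗ[ℝ] g)
    (φ : Quadric 𝒜 → Quadric 𝒜) : Prop :=
  ∀ a b : Int g, φ (QuotientGroup.mk a) = QuotientGroup.mk b →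
    ∃ F : (Fin n → ℂ) × (Fin k → ℝ) → (Fin n → ℂ) × (Fin k → ℝ),
      F 0 = 0 ∧ ContDiffAt ℝ ∞ F 0 ∧
      (∀ᶠ v in 𝓝 0, φ (chart 𝒜 i₁ i₂ a v) = chart 𝒜 i₁ i₂ b (F v)) ∧
      ∃ L : (Fin n → ℂ) →ₗ[ℂ] (Fin n → ℂ), ∀ z, fderiv ℝ F 0 (z, 0) = (L z, 0)

/-- CR automorphisms of `Q̂`: the CR maps that have an inverse that is a CR map. -/
def IsCRAutomorphism (𝒜 : ℤ → Submodule ℝ g) (i₁ : (Fin n → ℂ) →ₗ[ℝ] g)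
    (i₂ : (Fin k → ℝ) →ₗ[ℝ] g) (γ : Equiv.Perm (Quadric 𝒜)) : Prop :=
  IsCRMap 𝒜 i₁ i₂ γ ∧ IsCRMap 𝒜 i₁ i₂ γ.symm

/-- `Ad(γ)(X) = Y`, that is, `γ ∘ exp(tX) ∘ γ⁻¹ = exp(tY)` as transformations of `Q̂` for all
`t ∈ ℝ`; in other words, `γ` maps the vector field on `Q̂` generated by `X` to the one generated
by `Y`. -/
def AdEq (𝒜 : ℤ → Submodule ℝ g) (γ : Equiv.Perm (Quadric 𝒜)) (X Y : g) : Prop :=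
  ∀ (t : ℝ) (x : Quadric 𝒜), γ (expAd (t • X) • γ.symm x) = expAd (t • Y) • x

end Quadric

end CRQuadric

namespace CRQuadric

/-! ### Algebra of vector valued hermitian forms: prolongations of low degree -/

section Forms

variable {n k : ℕ} {H : SesqForm n k}

/-! The proof shows that `E` lies in `[𝔤, 𝔤]`, and then that this forces its radical component to
vanish.

Geometry (`mem_derivedSeries_of_adEq`): let `γ` send the base point `o` to `b · o` and put `X =
Ad(b⁻¹)(-E)`. Then `exp(tX)` fixes `o`, and the differential of `γ` conjugates the action of
`exp(tE)` on the complex tangent space `𝔤₋₁` to that of `exp(tX)`. The former is the scalar `e⁻ᵗ`,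
hence so is the latter; by transitivity the degree zero component of `X` is `E`. The other
components lie in `[𝔤, 𝔤]` because `ad E` is a nonzero scalar on each of them, so `X ≡ E` modulo
`[𝔤, 𝔤]`. But `Int(𝔤)` acts trivially on `𝔤 / [𝔤, 𝔤]`, so `X ≡ -E` as well, and `2E ∈ [𝔤, 𝔤]`.

Algebra (`radical_component_eq_zero`): `E_𝔯` commutes with `𝔰`, so `ad E` and `ad E_𝔰` commute. Both
are semisimple, the second because `E_𝔰` is ad-semisimple in `𝔰` and `𝔤` is an `𝔰`-module. Since
`E_𝔯` lies in the radical and in `[𝔤, 𝔤]`, its adjoint action is nilpotent. Being also the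
difference of commuting semisimple maps, it is zero, and transitivity gives `E_𝔯 = 0`.

Both halves need `dim 𝔤 < ∞`, which is derived from nondegeneracy and fundamentality
(`HasNonposPart.finite`). -/

lemma imForm_apply (z z' : Fin n → ℂ) (j : Fin k) : imForm H z z' j = (H z z' j).im := rfl

lemma imForm_swap (hh : IsHermitianForm H) (z z' : Fin n → ℂ) : imForm H z z' = -imForm H z' z := by
  ext j; simp [imForm_apply, hh z z' j]

/-- A vector that is `H`-orthogonal to everything vanishes. -/
lemma eq_zero_of_forall_imForm (hnd : IsNondegenerate H) {v : Fin n → ℂ}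
    (h : ∀ d, imForm H v d = 0) : v = 0 := by
  by_contra hv
  obtain ⟨d, hd⟩ := hnd v hv
  apply hd
  ext j
  have h1 := congrFun (h d) j
  have h2 := congrFun (h (Complex.I • d)) j
  simp [imForm_apply] at h1 h2
  exact Complex.ext h2 h1

lemma eq_zero_of_forall_apply_left (hnd : IsNondegenerate H) {v : Fin n → ℂ}
    (h : ∀ d, H v d = 0) : v = 0 := by
  by_contra hv
  obtain ⟨d, hd⟩ := hnd v hv
  exact hd (h d)

/-- The first prolongation of the unitary algebra of a nondegenerate hermitian form vanishes. -/
lemma skew_prolongation_eq_zero (hh : IsHermitianForm H) (hnd : IsNondegenerate H)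
    (A : (Fin n → ℂ) → (Fin n → ℂ) →ₗ[ℂ] (Fin n → ℂ)) (hsymm : ∀ z c, A z c = A c z)
    (hskew : ∀ z c d, imForm H (A z c) d + imForm H c (A z d) = 0) (z d : Fin n → ℂ) :
    A z d = 0 := by
  -- Replacing `c` by `ic` gives that the sum of `Re H(A z c, d)` and `Re H(c, A z d)` is zero.
  -- Replacing `z` by `iz` gives that their difference is zero; here the symmetry makes `A` complex
  -- linear in `z`.
  have key : ∀ c j, (H c (A z d) j).re = 0 := by
    intro c j
    have h1 := congrFun (hskew z (Complex.I • c) d) j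
    have h2 := congrFun (hskew (Complex.I • z) c d) j
    have e1 : ∀ c, A (Complex.I • z) c = Complex.I • A z c := fun c => by
      rw [hsymm, map_smul, hsymm]
    simp [imForm_apply, e1] at h1 h2
    linarith
  apply eq_zero_of_forall_imForm hnd
  intro c
  have h := fun j => key (Complex.I • c) j
  rw [imForm_swap hh]
  ext j
  simpa [imForm_apply] using h j

/-- The relations satisfied by an element of degree two of a Levi-Tanaka algebra: `A w` is the
bracket with `w ∈ 𝔤₋₂` and `P a b` the iterated bracket with `a, b ∈ 𝔤₋₁`. -/
lemma degree_two_relations (hnd : IsNondegenerate H) (hh : IsHermitianForm H)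
    (A : (Fin k → ℝ) → (Fin n → ℂ) →ₗ[ℂ] (Fin n → ℂ))
    (P : (Fin n → ℂ) → (Fin n → ℂ) → (Fin n → ℂ) →ₗ[ℂ] (Fin n → ℂ))
    (hneg : ∀ w c, A (-w) c = -A w c)
    (r1 : ∀ a b c, P a b c - P b a c = A (imForm H a b) c)
    (r2 : ∀ a b c, P a b c - P a c b = A (imForm H b c) a)
    (r3 : ∀ a b c d, imForm H (A (imForm H c d) a) b =
      imForm H (P a b c) d + imForm H c (P a b d)) (z : Fin n → ℂ) :
    P z z z = (3 / 2 * Complex.I) • A (imForm H (Complex.I • z) z) z ∧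
      imForm H (A (imForm H (Complex.I • z) z) z) z = 0 := by
  set y : Fin n → ℂ := Complex.I • z with hy
  set m := A (imForm H y z) z with hm
  have hP1 : ∀ a b, P a b y = Complex.I • P a b z := fun a b => by rw [hy, map_smul]
  have hA1 : ∀ w, A w y = Complex.I • A w z := fun a => by rw [hy, map_smul]
  have hzy : imForm H z y = -imForm H y z := imForm_swap hh _ _
  have q1 : P z y z = Complex.I • P z z z + m := by
    have := r2 z z y
    rw [hP1, hzy, hneg] at this
    linear_combination (exp := 1) -this
  have q2 : P y z z = P z y z + m := by
    have := r1 y z z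
    linear_combination (exp := 1) this
  have q3 : P y y z = Complex.I • P y z z + Complex.I • m := by
    have := r2 y z y
    rw [hP1, hzy, hneg, hA1] at this
    linear_combination (exp := 1) -this
  have hII : ∀ v : Fin n → ℂ, Complex.I • Complex.I • v = -v := fun v => by
    rw [smul_smul, Complex.I_mul_I, neg_one_smul]
  -- Split real bilinear maps of `(a, b)` into parts linear or antilinear in each variable. `hPi`
  -- says that the (antilinear, antilinear) part of `P a b d` vanishes at `(z, z)`; `hsig` computes
  -- four times the (linear, linear) part of `P a b z` there. Take the (linear, linear) part of
  -- `key`: `H z` is antilinear, so the term in `P a b d` drops out by `hPi`; so does the right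
  -- side, as `Im H(A w a, b)` has only mixed parts.
  have main : P z z z = (3 / 2 * Complex.I) • m := by
    rw [← sub_eq_zero]
    apply eq_zero_of_forall_apply_left hnd
    intro d
    have s1 : ∀ a, P a z d = P a d z + A (imForm H z d) a := fun a => by
      rw [← r2 a z d]; abel
    have s2 : ∀ a, P a y d = Complex.I • P a d z + A (imForm H y d) a := fun a => by
      rw [← r2 a y d, hP1]; abel
    have hPi : P z z d + Complex.I • P y z d + Complex.I • P z y d - P y y d = 0 := by
      rw [s1, s1, s2, s2, hA1, hA1]
      simp only [smul_add, hII]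
      abel
    have hPi' : ∀ j, H z (P z z d) j - Complex.I * H z (P y z d) j - Complex.I * H z (P z y d) j
        - H z (P y y d) j = 0 := by
      intro j
      have := congrFun (congrArg (H z) hPi) j
      simp at this
      linear_combination this
    have hsig : P z z z - Complex.I • P y z z - Complex.I • P z y z - P y y z =
        (4 : ℂ) • (P z z z - (3 / 2 * Complex.I) • m) := by
      rw [q3, q2, q1]
      simp only [smul_add, hII]
      module
    have key : ∀ a b j, H (P a b z) d j + H z (P a b d) j =
        ((H (A (imForm H y d) a) b j).im : ℂ) + Complex.I * (H (A (imForm H z d) a) b j).im := by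
      intro a b j
      have e1 := congrFun (r3 a b y d) j
      have e2 := congrFun (r3 a b z d) j
      rw [hP1, hy] at e1
      simp [imForm_apply] at e1 e2
      rw [← hy] at e1
      apply Complex.ext
      · simp; linarith
      · simp; linarith
    ext j
    have hs := congrFun (congrArg (fun v => H v d) hsig) j
    simp only [map_sub, map_smul, LinearMap.sub_apply, LinearMap.smul_apply, Pi.sub_apply,
      Pi.smul_apply, smul_eq_mul] at hs
    have k1 := key z z j
    have k2 := key y z j
    have k3 := key z y j
    have k4 := key y y j
    rw [hA1, hA1] at k2 k4
    rw [hy] at k3 k4 k2 hs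
    have := hPi' j
    rw [hy] at this
    simp only [map_sub, map_smul, LinearMap.sub_apply, LinearMap.smul_apply, Pi.sub_apply,
      Pi.smul_apply, smul_eq_mul, Pi.zero_apply]
    simp [map_smulₛₗ] at k1 k2 k3 k4
    rw [hy] at k1
    linear_combination (1 / 4) * (-hs + k1 - Complex.I * k2 - Complex.I * k3 - k4 - this)
  refine ⟨main, ?_⟩
  -- By `main` this identity becomes `Im H(m, z) = -3 Im H(m, z)`.
  have e := r3 z z y z
  rw [hP1, main, ← hm] at e
  ext j
  have e := congrFun e j
  have h1 := hh z m j
  have h2 := congrArg Complex.im h1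
  have h3 : starRingEnd ℂ 3 = 3 := map_ofNat _ 3
  have h4 : starRingEnd ℂ 2 = 2 := map_ofNat _ 2
  simp [imForm_apply, hy, h3, h4] at e h2 ⊢
  linarith

/-- The span of the vectors `[iz, z] = H(z, z)` is `𝔤₋₂`. -/
lemma IsFundamental.span_imForm_eq_top (hf : IsFundamental H) :
    Submodule.span ℝ (Set.range fun z : Fin n → ℂ => imForm H (Complex.I • z) z) = ⊤ := by
  rw [IsFundamental] at hf
  rw [← hf]
  congr 2
  ext z j
  simp [imForm_apply]

end Forms

/-! ### Finite dimensionality of the Levi-Tanaka algebra -/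

section FiniteDimensional

variable {n k : ℕ} {H : SesqForm n k} {g : Type u} [LieRing g] [LieAlgebra ℝ g]
  {𝒜 : ℤ → Submodule ℝ g} {i₁ : (Fin n → ℂ) →ₗ[ℝ] g} {i₂ : (Fin k → ℝ) →ₗ[ℝ] g}

lemma IsLieGrading.lie_mem' (hG : IsLieGrading 𝒜) {i j l : ℤ} {X Y : g} (hX : X ∈ 𝒜 i)
    (hY : Y ∈ 𝒜 j) (h : i + j = l := by norm_num) : ⁅X, Y⁆ ∈ 𝒜 l := h ▸ hG.lie_mem hX hY

namespace HasNonposPart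

variable (hN : HasNonposPart H 𝒜 i₁ i₂)
include hN

lemma i₁_mem (z : Fin n → ℂ) : i₁ z ∈ 𝒜 (-1) := hN.range₁ ▸ LinearMap.mem_range_self i₁ z

lemma i₂_mem (w : Fin k → ℝ) : i₂ w ∈ 𝒜 (-2) := hN.range₂ ▸ LinearMap.mem_range_self i₂ w

lemma exists_eq_i₁ {X : g} (hX : X ∈ 𝒜 (-1)) : ∃ z, i₁ z = X := by
  rwa [← hN.range₁] at hX

lemma lie_i₁_i₂ (hG : IsLieGrading 𝒜) (z : Fin n → ℂ) (w : Fin k → ℝ) : ⁅i₁ z, i₂ w⁆ = 0 := by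
  have := hG.lie_mem' (l := -3) (hN.i₁_mem z) (hN.i₂_mem w)
  rwa [hN.eq_bot _ (by norm_num), Submodule.mem_bot] at this

lemma lie_i₂_i₂ (hG : IsLieGrading 𝒜) (w w' : Fin k → ℝ) : ⁅i₂ w, i₂ w'⁆ = 0 := by
  have := hG.lie_mem' (l := -4) (hN.i₂_mem w) (hN.i₂_mem w')
  rwa [hN.eq_bot _ (by norm_num), Submodule.mem_bot] at this

/-- In degree one, if `X` kills `𝔤₋₂` then `(z, c) ↦ [[X, z], c]` is symmetric and skew for `Im H`,
so `skew_prolongation_eq_zero` and transitivity apply. Higher degrees follow by transitivity, since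
bracketing with `𝔤₋₁` preserves the condition. -/
lemma lie_i₂_eq_zero (hG : IsLieGrading 𝒜) (hT : IsTransitive 𝒜) (hh : IsHermitianForm H)
    (hnd : IsNondegenerate H) {p : ℤ} (hp : 1 ≤ p) {X : g} (hX : X ∈ 𝒜 p)
    (h : ∀ w, ⁅X, i₂ w⁆ = 0) : X = 0 := by
  induction p, hp using Int.leInduction generalizing X with
  | base =>
    have h0 : ∀ z, ⁅X, i₁ z⁆ ∈ 𝒜 0 := fun z => hG.lie_mem' hX (hN.i₁_mem z)
    choose A hA using fun z => hN.zero_complexLinear _ (h0 z)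
    have hA0 := skew_prolongation_eq_zero hh hnd A ?_ ?_
    · by_contra hX0
      obtain ⟨Y, hY, hXY⟩ := hT 1 (by norm_num) X hX hX0
      obtain ⟨z, rfl⟩ := hN.exists_eq_i₁ hY
      obtain ⟨Y', hY', hXY'⟩ := hT 0 le_rfl _ (h0 z) hXY
      obtain ⟨z', rfl⟩ := hN.exists_eq_i₁ hY'
      exact hXY' (by rw [hA, hA0, map_zero])
    · intro z c
      apply hN.injective₁
      have := leibniz_lie X (i₁ z) (i₁ c)
      rw [hN.bracket, h, hA, ← lie_skew (i₁ z), hA] at this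
      rwa [eq_comm, ← sub_eq_add_neg, sub_eq_zero] at this
    · intro z c d
      apply hN.injective₂
      have h1 : ∀ w, ⁅⁅X, i₁ z⁆, i₂ w⁆ = 0 := fun w => by
        rw [lie_lie, hN.lie_i₁_i₂ hG, h]; simp
      have := leibniz_lie ⁅X, i₁ z⁆ (i₁ c) (i₁ d)
      rw [hN.bracket, h1, hA, hA, hN.bracket, hN.bracket] at this
      rw [map_add, map_zero, this]
  | succ p hp ih =>
    by_contra hX0
    obtain ⟨Y, hY, hXY⟩ := hT (p + 1) (by omega) X hX hX0
    obtain ⟨z, rfl⟩ := hN.exists_eq_i₁ hY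
    refine hXY (ih (hG.lie_mem' hX (hN.i₁_mem z) (by ring)) fun w => ?_)
    rw [lie_lie, hN.lie_i₁_i₂ hG, h]; simp

lemma degree_two (hG : IsLieGrading 𝒜) (hh : IsHermitianForm H)
    (hnd : IsNondegenerate H) {Y : g} (hY : Y ∈ 𝒜 2) (z : Fin n → ℂ) :
    ∃ m, ⁅⁅Y, i₂ (imForm H (Complex.I • z) z)⁆, i₁ z⁆ = i₁ m ∧
      ⁅⁅⁅Y, i₁ z⁆, i₁ z⁆, i₁ z⁆ = i₁ ((3 / 2 * Complex.I) • m) ∧ imForm H m z = 0 := by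
  have h0 : ∀ w, ⁅Y, i₂ w⁆ ∈ 𝒜 0 := fun w => hG.lie_mem' hY (hN.i₂_mem w)
  choose A hA using fun w => hN.zero_complexLinear _ (h0 w)
  have h1 : ∀ a b, ⁅⁅Y, i₁ a⁆, i₁ b⁆ ∈ 𝒜 0 := fun a b =>
    hG.lie_mem' (hG.lie_mem' (l := 1) hY (hN.i₁_mem a)) (hN.i₁_mem b)
  choose P hP using fun a b => hN.zero_complexLinear _ (h1 a b)
  have h2 : ∀ a w, ⁅⁅Y, i₁ a⁆, i₂ w⁆ = i₁ (A w a) := fun a w => by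
    rw [lie_lie, hN.lie_i₁_i₂ hG, lie_zero, ← lie_skew, hA]; simp
  have key := degree_two_relations hnd hh A P ?_ ?_ ?_ ?_ z
  · exact ⟨_, hA _ _, by rw [hP, key.1], key.2⟩
  · intro w c
    apply hN.injective₁
    rw [← hA, map_neg, lie_neg, neg_lie, hA, map_neg]
  · intro a b c
    apply hN.injective₁
    rw [map_sub, ← hP, ← hP, ← hA, ← hN.bracket, leibniz_lie Y, add_lie, ← lie_skew (i₁ a), neg_lie]
    abel
  · intro a b c
    apply hN.injective₁
    rw [map_sub, ← hP, ← hP, ← h2, ← hN.bracket, leibniz_lie _ (i₁ b), ← lie_skew (i₁ b)]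
    abel
  · intro a b c d
    apply hN.injective₂
    have := leibniz_lie ⁅⁅Y, i₁ a⁆, i₁ b⁆ (i₁ c) (i₁ d)
    rw [hP, hP, hN.bracket, hN.bracket, hN.bracket, lie_lie, hN.lie_i₁_i₂ hG, lie_zero, h2,
      hN.bracket, imForm_swap hh b] at this
    rw [map_add, ← this]
    simp

/-- With `w = [iz, z]`, apply `degree_two` to `Y = [X, w]` and to `U = [[X, z], z]`. As `z` and `w`
commute, the vector `m'` of `U` is `(3/2) i m`, so `Im H(m', z) = 0` says `Re H(m, z) = 0`. Finally
`[[Y, w], [iz, z]] = [im, z] + [iz, m]` is `2 Re H(m, z)`. -/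
lemma degree_four (hG : IsLieGrading 𝒜) (hh : IsHermitianForm H)
    (hnd : IsNondegenerate H) {X : g} (hX : X ∈ 𝒜 4) (z : Fin n → ℂ) :
    ⁅⁅⁅X, i₂ (imForm H (Complex.I • z) z)⁆, i₂ (imForm H (Complex.I • z) z)⁆,
      i₂ (imForm H (Complex.I • z) z)⁆ = 0 := by
  set w := imForm H (Complex.I • z) z with hw
  have hY : ⁅X, i₂ w⁆ ∈ 𝒜 2 := hG.lie_mem' hX (hN.i₂_mem w)
  have hU : ⁅⁅X, i₁ z⁆, i₁ z⁆ ∈ 𝒜 2 :=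
    hG.lie_mem' (hG.lie_mem' (l := 3) hX (hN.i₁_mem z)) (hN.i₁_mem z)
  obtain ⟨m, m1, m2, m3⟩ := hN.degree_two hG hh hnd hY z
  obtain ⟨m', m1', -, m3'⟩ := hN.degree_two hG hh hnd hU z
  have hc : ∀ Z : g, ⁅⁅Z, i₁ z⁆, i₂ w⁆ = ⁅⁅Z, i₂ w⁆, i₁ z⁆ := fun Z => by
    rw [lie_lie, hN.lie_i₁_i₂ hG, lie_zero, ← lie_skew]; simp
  rw [← hw, hc, hc, m2] at m1'
  obtain rfl := hN.injective₁ m1'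
  obtain ⟨A, hA⟩ := hN.zero_complexLinear _
    (hG.lie_mem' (l := 0) hY (hN.i₂_mem w))
  have hAm : A z = m := hN.injective₁ (by rw [← hA, ← m1])
  have := leibniz_lie ⁅⁅X, i₂ w⁆, i₂ w⁆ (i₁ (Complex.I • z)) (i₁ z)
  rw [hN.bracket, hA, hA, map_smul, hAm, hN.bracket, hN.bracket, ← map_add, ← hw] at this
  rw [this, ← map_zero i₂]
  congr 1
  ext j
  have e1 := congrFun m3' j
  have e2 := congrArg Complex.re (hh m z j)
  simp [imForm_apply] at e1 e2 ⊢
  linarith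

/-- The bracket with `[iz, z]` is nilpotent of order three in degree at least four. -/
lemma lie_lie_lie_eq_zero (hG : IsLieGrading 𝒜) (hT : IsTransitive 𝒜) (hh : IsHermitianForm H)
    (hnd : IsNondegenerate H) {p : ℤ} (hp : 4 ≤ p) {X : g} (hX : X ∈ 𝒜 p) (z : Fin n → ℂ) :
    ⁅⁅⁅X, i₂ (imForm H (Complex.I • z) z)⁆, i₂ (imForm H (Complex.I • z) z)⁆,
      i₂ (imForm H (Complex.I • z) z)⁆ = 0 := by
  induction p, hp using Int.leInduction generalizing X with
  | base => exact hN.degree_four hG hh hnd hX z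
  | succ p hp ih =>
    set w := imForm H (Complex.I • z) z with hw
    have hmem : ⁅⁅⁅X, i₂ w⁆, i₂ w⁆, i₂ w⁆ ∈ 𝒜 (p - 5) :=
      hG.lie_mem' (hG.lie_mem' (hG.lie_mem' hX (hN.i₂_mem w) rfl) (hN.i₂_mem w) rfl)
        (hN.i₂_mem w) (by ring)
    have hc : ∀ (Z : g) c, ⁅⁅Z, i₂ w⁆, i₁ c⁆ = ⁅⁅Z, i₁ c⁆, i₂ w⁆ := fun Z c => by
      rw [lie_lie _ (i₁ c), hN.lie_i₁_i₂ hG, lie_zero, ← lie_skew]; simp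
    have h0 : ∀ c, ⁅⁅⁅⁅X, i₂ w⁆, i₂ w⁆, i₂ w⁆, i₁ c⁆ = 0 := fun c => by
      rw [hc, hc, hc]
      exact ih (hG.lie_mem' hX (hN.i₁_mem c) (by ring))
    by_contra hne
    -- The triple bracket has degree `p - 5`. For `p = 4` this is `-1`, where transitivity says
    -- nothing and nondegeneracy of `H` replaces it.
    rcases le_or_gt 5 p with h5 | h5
    · obtain ⟨Y, hY, hXY⟩ := hT (p - 5) (by omega) _ hmem hne
      obtain ⟨c, rfl⟩ := hN.exists_eq_i₁ hY
      exact hXY (h0 c)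
    · obtain rfl : p = 4 := by omega
      obtain ⟨v, hv⟩ := hN.exists_eq_i₁ hmem
      rw [← hv] at h0 hne
      apply hne
      rw [eq_zero_of_forall_imForm hnd (v := v), map_zero]
      intro d
      apply hN.injective₂
      rw [← hN.bracket, h0, map_zero]

/-- The brackets with the vectors `[iz, z]` commute and are nilpotent of order three. For each `z`
in turn, pass to the last nonzero element among `Y`, `[Y, w]`, `[[Y, w], w]`. This lowers the degree
by at most four, and the bound on `p` keeps it at least four throughout. -/
lemma exists_lie_eq_zero (hG : IsLieGrading 𝒜) (hT : IsTransitive 𝒜) (hh : IsHermitianForm H)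
    (hnd : IsNondegenerate H) (s : Finset (Fin n → ℂ)) {p : ℤ} (hp : 4 + 4 * s.card ≤ p) {X : g}
    (hX : X ∈ 𝒜 p) (hX0 : X ≠ 0) :
    ∃ q, p - 4 * s.card ≤ q ∧ ∃ Y ∈ 𝒜 q, Y ≠ 0 ∧
      ∀ z ∈ s, ⁅Y, i₂ (imForm H (Complex.I • z) z)⁆ = 0 := by
  classical
  induction s using Finset.induction_on with
  | empty => exact ⟨p, by simp, X, hX, hX0, by simp⟩
  | insert z s hz ih =>
    rw [Finset.card_insert_of_notMem hz] at hp ⊢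
    push_cast at hp ⊢
    obtain ⟨q, hq, Y, hY, hY0, hYs⟩ := ih (by omega)
    have h3 := hN.lie_lie_lie_eq_zero hG hT hh hnd (by omega) hY z
    set w := imForm H (Complex.I • z) z with hw
    have hc : ∀ (Z : g) w', ⁅⁅Z, i₂ w⁆, i₂ w'⁆ = ⁅⁅Z, i₂ w'⁆, i₂ w⁆ := fun Z w' => by
      rw [lie_lie _ _ (i₂ w'), hN.lie_i₂_i₂ hG, lie_zero, ← lie_skew]; simp
    by_cases h1 : ⁅Y, i₂ w⁆ = 0
    · refine ⟨q, by omega, Y, hY, hY0, fun c hc => ?_⟩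
      rcases Finset.mem_insert.1 hc with rfl | hc
      exacts [h1, hYs c hc]
    by_cases h2 : ⁅⁅Y, i₂ w⁆, i₂ w⁆ = 0
    · refine ⟨q - 2, by omega, _, hG.lie_mem' hY (hN.i₂_mem w) rfl, h1, fun c hcs => ?_⟩
      rcases Finset.mem_insert.1 hcs with rfl | hcs
      · exact h2
      · rw [hc, hYs c hcs, zero_lie]
    · refine ⟨q - 4, by omega, _, hG.lie_mem' (hG.lie_mem' hY (hN.i₂_mem w) rfl) (hN.i₂_mem w)
        (by ring), h2, fun c hcs => ?_⟩
      rcases Finset.mem_insert.1 hcs with rfl | hcs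
      · exact h3
      · rw [hc, hc Y, hYs c hcs, zero_lie, zero_lie]

/-- The prolongation is of finite type. -/
lemma exists_bound (hG : IsLieGrading 𝒜) (hT : IsTransitive 𝒜) (hh : IsHermitianForm H)
    (hnd : IsNondegenerate H) (hf : IsFundamental H) : ∃ N : ℤ, ∀ p, N ≤ p → 𝒜 p = ⊥ := by
  classical
  obtain ⟨t, ht, hspan⟩ := (Submodule.fg_span_iff_fg_span_finset_subset (R := ℝ)
    (Set.range fun z : Fin n → ℂ => imForm H (Complex.I • z) z)).1 (IsNoetherian.noetherian _)
  rw [hf.span_imForm_eq_top] at hspan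
  obtain ⟨s, rfl⟩ : ∃ s : Finset (Fin n → ℂ),
      s.image (fun z : Fin n → ℂ => imForm H (Complex.I • z) z) = t := by
    obtain ⟨s, -, hs⟩ := Finset.subset_set_image_iff.1 (Set.image_univ ▸ ht)
    exact ⟨s, hs⟩
  refine ⟨4 + 4 * s.card, fun p hp => ?_⟩
  rw [Submodule.eq_bot_iff]
  intro X hX
  by_contra hX0
  -- The vectors `[iz, z]` with `z ∈ s` span `𝔤₋₂`, so `Y` is a nonzero element of positive degree
  -- that kills `𝔤₋₂`.
  obtain ⟨q, hq, Y, hY, hY0, hYs⟩ := hN.exists_lie_eq_zero hG hT hh hnd s hp hX hX0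
  refine hY0 (hN.lie_i₂_eq_zero hG hT hh hnd (by omega) hY fun w => ?_)
  have hw : w ∈ Submodule.span ℝ (↑(s.image fun z : Fin n → ℂ => imForm H (Complex.I • z) z) :
    Set (Fin k → ℝ)) := hspan ▸ Submodule.mem_top
  induction hw using Submodule.span_induction with
  | mem x hx =>
    obtain ⟨z, hz, rfl⟩ := Finset.mem_image.1 (Finset.mem_coe.1 hx)
    exact hYs z hz
  | zero => simp
  | add x y _ _ hx hy => rw [map_add, lie_add, hx, hy, add_zero]
  | smul a x _ hx => rw [map_smul, lie_smul, hx, smul_zero]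

lemma finite_component (hG : IsLieGrading 𝒜) (hT : IsTransitive 𝒜) (p : ℤ) :
    Module.Finite ℝ (𝒜 p) := by
  have h2 : Module.Finite ℝ (𝒜 (-2)) := hN.range₂ ▸ inferInstance
  have h1 : Module.Finite ℝ (𝒜 (-1)) := hN.range₁ ▸ inferInstance
  rcases lt_or_ge p (-2) with hp | hp
  · rw [hN.eq_bot p hp]; infer_instance
  rcases eq_or_lt_of_le hp with rfl | hp
  · exact h2
  replace hp : -1 ≤ p := by omega
  induction p, hp using Int.leInduction with
  | base => exact h1
  | succ p hp ih =>
    have := ih (by omega)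
    let f : 𝒜 (p + 1) →ₗ[ℝ] (Fin n → ℂ) →ₗ[ℝ] 𝒜 p :=
      { toFun := fun X => LinearMap.codRestrict (𝒜 p) ((LieAlgebra.ad ℝ g X : g →ₗ[ℝ] g) ∘ₗ i₁)
          fun z => hG.lie_mem' X.2 (hN.i₁_mem z) (by ring)
        map_add' := fun X Y => LinearMap.ext fun z => Subtype.ext (add_lie X.1 Y.1 (i₁ z))
        map_smul' := fun c X => LinearMap.ext fun z => Subtype.ext (smul_lie c X.1 (i₁ z)) }
    refine Module.Finite.of_injective f ((injective_iff_map_eq_zero f).2 fun X hX => ?_)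
    by_contra hX0
    obtain ⟨Y, hY, hXY⟩ := hT (p + 1) (by omega) X X.2 (by simpa using hX0)
    obtain ⟨z, rfl⟩ := hN.exists_eq_i₁ hY
    exact hXY (congrArg Subtype.val (LinearMap.congr_fun hX z))

theorem finite (hG : IsLieGrading 𝒜) (hT : IsTransitive 𝒜) (hh : IsHermitianForm H)
    (hnd : IsNondegenerate H) (hf : IsFundamental H) : Module.Finite ℝ g := by
  obtain ⟨N, hNb⟩ := hN.exists_bound hG hT hh hnd hf
  have h1 : ⨆ p : ℤ, 𝒜 p = ⨆ p ∈ Finset.Icc (-2) N, 𝒜 p := by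
    refine le_antisymm (iSup_le fun p => ?_) (iSup₂_le fun p _ => le_iSup 𝒜 p)
    by_cases hp : p ∈ Finset.Icc (-2) N
    · exact le_iSup₂_of_le p hp le_rfl
    · rw [Finset.mem_Icc, not_and_or, not_le, not_le] at hp
      rcases hp with hp | hp
      · rw [hN.eq_bot p hp]; exact bot_le
      · rw [hNb p hp.le]; exact bot_le
  have := fun p => hN.finite_component hG hT p
  rw [hG.isInternal.submodule_iSup_eq_top] at h1
  refine ⟨?_⟩
  rw [h1]
  exact Submodule.fg_biSup _ _ fun p _ => (Submodule.fg_top _).1 (this p).fg_top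

end HasNonposPart

end FiniteDimensional
-- Finite dimensional representations of `𝔰𝔩₂`
section Semisimple

variable {K M : Type*} [Field K] [AddCommGroup M] [Module K M]

open Module Polynomial

lemma isSemisimple_of_iSup_eigenspace_eq_top [FiniteDimensional K M] {T : End K M}
    (h : ⨆ μ, T.eigenspace μ = ⊤) : T.IsSemisimple := by
  classical
  have hfin : {μ | T.HasEigenvalue μ}.Finite := T.finite_hasEigenvalue
  refine End.isSemisimple_of_squarefree_aeval_eq_zero
    (p := ∏ μ ∈ hfin.toFinset, (X - C μ)) ?_ ?_
  · exact (Polynomial.separable_prod_X_sub_C_iff'.2 fun _ _ _ _ h => h).squarefree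
  · rw [← LinearMap.ker_eq_top, eq_top_iff, ← h, iSup_le_iff]
    intro μ v hv
    by_cases h0 : v = 0
    · simp [h0]
    have hμ : μ ∈ hfin.toFinset := by
      simpa using End.hasEigenvalue_of_hasEigenvector ⟨hv, h0⟩
    rw [LinearMap.mem_ker, ← Finset.prod_erase_mul _ _ hμ, map_mul, Module.End.mul_apply]
    rw [Module.End.mem_eigenspace_iff] at hv
    simp [hv, Algebra.algebraMap_eq_smul_one]

/-- Otherwise the powers `e ^ n` would be eigenvectors of `x ↦ hx - xh` for the infinitely many
eigenvalues `n c`. -/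
lemma isNilpotent_of_mul_sub_mul_eq_smul [CharZero K] [FiniteDimensional K M] {h e : End K M}
    {c : K} (hc : c ≠ 0) (he : h * e - e * h = c • e) : IsNilpotent e := by
  by_contra hne
  let T : End K (End K M) := LinearMap.mulLeft K h - LinearMap.mulRight K h
  have hT : ∀ x, T x = h * x - x * h := fun x => rfl
  have hpow : ∀ n : ℕ, T (e ^ n) = (n * c) • e ^ n := by
    intro n
    induction n with
    | zero => simp [hT]
    | succ n ih =>
      have : T (e ^ (n + 1)) = T (e ^ n) * e + e ^ n * (h * e - e * h) := by
        simp only [hT, pow_succ]; noncomm_ring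
      rw [this, ih, he, pow_succ]
      simp only [smul_mul_assoc, mul_smul_comm, ← add_smul]
      push_cast; congr 1; ring
  have hinj : Function.Injective fun n : ℕ => (n : K) * c := fun a b hab => by
    simpa [hc] using hab
  refine Set.infinite_of_injective_forall_mem hinj (fun n => ?_) T.finite_hasEigenvalue
  exact End.hasEigenvalue_of_hasEigenvector (x := e ^ n)
    ⟨End.mem_eigenspace_iff.2 (hpow n), fun h0 => hne ⟨n, h0⟩⟩

/-- Endomorphisms `h, e, f` satisfying the relations of an `𝔰𝔩₂` triple. -/
structure IsSl2Action (h e f : End K M) : Prop where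
  he : h * e - e * h = (2 : K) • e
  hf : h * f - f * h = -((2 : K) • f)
  ef : e * f - f * e = h

namespace IsSl2Action

variable {h e f : End K M} (t : IsSl2Action h e f)
include t

lemma e_mul_f_pow (J : ℕ) :
    e * f ^ (J + 1) = f ^ (J + 1) * e + ((J + 1 : ℕ) : K) • (f ^ J * (h - (J : K) • 1)) := by
  have h1 : e * f = f * e + h := by rw [← t.ef]; abel
  have h2 : h * f = f * h - (2 : K) • f := by rw [sub_eq_add_neg, ← t.hf]; abel
  induction J with
  | zero => simp [h1]
  | succ J ih =>
    rw [pow_succ f (J + 1), ← mul_assoc, ih, add_mul, mul_assoc, h1, smul_mul_assoc, mul_assoc,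
      sub_mul, h2, pow_succ f J]
    simp only [mul_add, mul_sub, smul_mul_assoc, mul_smul_comm, one_mul, mul_one, mul_assoc]
    push_cast
    module

lemma semiconj_e (ν : K) : SemiconjBy e (h - ν • 1) (h - (ν + 2) • 1) := by
  have h1 : h * e = e * h + (2 : K) • e := by rw [← t.he]; abel
  rw [SemiconjBy, sub_mul, h1, mul_sub]
  simp only [smul_mul_assoc, mul_smul_comm, one_mul, mul_one]
  module

lemma e_mem {ν : K} {v : M} (hv : v ∈ h.maxGenEigenspace ν) :
    e v ∈ h.maxGenEigenspace (ν + 2) := by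
  rw [End.mem_maxGenEigenspace] at hv ⊢
  obtain ⟨m, hm⟩ := hv
  refine ⟨m, ?_⟩
  have := LinearMap.congr_fun ((t.semiconj_e ν).pow_right m).eq v
  rw [End.mul_apply, End.mul_apply, hm, map_zero] at this
  exact this.symm

lemma e_pow_mem {ν : K} {v : M} (hv : v ∈ h.maxGenEigenspace ν) (k : ℕ) :
    (e ^ k) v ∈ h.maxGenEigenspace (ν + 2 * k) := by
  induction k with
  | zero => simpa using hv
  | succ k ih =>
    rw [pow_succ', End.mul_apply]
    have := t.e_mem ih
    push_cast
    convert this using 2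
    ring

/-- `h` acts on the kernel of `e` semisimply and with natural eigenvalues. -/
lemma of_e_eq_zero [CharZero K] (J : ℕ) {ν : K} {v : M} (hv : v ∈ h.maxGenEigenspace ν)
    (hev : e v = 0) (hfv : (f ^ J) v = 0) : h v = ν • v ∧ (v = 0 ∨ ∃ i < J, ν = (i : K)) := by
  induction J generalizing v with
  | zero => simp_all
  | succ J ih =>
    have h1 := LinearMap.congr_fun (t.e_mul_f_pow J) v
    simp only [End.mul_apply, LinearMap.add_apply, hev, hfv, map_zero, zero_add,
      LinearMap.smul_apply] at h1
    -- From `e f^(J+1) v = (J+1) f^J (h - J) v`: the vector `(h - J) v` satisfies the hypotheses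
    -- with `J` in place of `J + 1`.
    have h2 : (f ^ J) ((h - (J : K) • 1) v) = 0 := by
      rcases smul_eq_zero.1 h1.symm with h | h
      · exact absurd h (Nat.cast_ne_zero.2 (Nat.succ_ne_zero J))
      · exact h
    have hcomm : Commute (h - (J : K) • 1) (h - ν • 1) := by
      apply Commute.sub_left <;> apply Commute.sub_right <;>
        simp [Commute.smul_right, Commute.smul_left]
    obtain ⟨m, hm⟩ := (End.mem_maxGenEigenspace _ _ _).1 hv
    have h3 : (h - (J : K) • 1) v ∈ h.maxGenEigenspace ν := by
      rw [End.mem_maxGenEigenspace]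
      refine ⟨m, ?_⟩
      rw [← End.mul_apply, ← (hcomm.pow_right m).eq, End.mul_apply, hm, map_zero]
    have h4 : e ((h - (J : K) • 1) v) = 0 := by
      have h5 := LinearMap.congr_fun t.he v
      simp [hev] at h5
      simp [h5, hev]
    obtain ⟨h6, h7⟩ := ih h3 h4 h2
    have h8 : (h - ν • 1) v = 0 ∧ (v = 0 ∨ ∃ i < J + 1, ν = (i : K)) := by
      by_cases hJ : ν = J
      · subst hJ
        rcases h7 with h7 | ⟨i, hi, h7⟩
        · exact ⟨h7, Or.inr ⟨J, by simp, rfl⟩⟩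
        · exact absurd (Nat.cast_injective h7) (by omega)
      · have h9 : (h - (J : K) • 1) ((h - ν • 1) v) = 0 := by
          rw [← End.mul_apply, hcomm.eq, End.mul_apply]
          simp only [LinearMap.sub_apply, LinearMap.smul_apply, End.one_apply] at h6 ⊢
          rw [h6, sub_self]
        -- A nonzero `(h - ν) v` would be an eigenvector of `h` for `J ≠ ν` inside the generalized
        -- eigenspace of `ν`.
        have hu : (h - ν • 1) v = 0 := by
          set u := (h - ν • 1) v with hu
          have hhu : (h - ν • 1) u = ((J : K) - ν) • u := by
            simp only [LinearMap.sub_apply, LinearMap.smul_apply, End.one_apply, sub_eq_zero] at h9 ⊢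
            rw [h9, sub_smul]
          have hpow : ∀ l : ℕ, ((h - ν • 1) ^ l) u = ((J : K) - ν) ^ l • u := by
            intro l
            induction l with
            | zero => simp
            | succ l ihl => rw [pow_succ', End.mul_apply, ihl, map_smul, hhu, smul_smul, pow_succ]
          have : ((h - ν • 1) ^ m) u = 0 := by
            rw [hu, ← End.mul_apply, ← pow_succ, pow_succ', End.mul_apply, hm, map_zero]
          rw [hpow] at this
          exact (smul_eq_zero.1 this).resolve_left
            (pow_ne_zero _ (sub_ne_zero.2 (Ne.symm hJ)))
        refine ⟨hu, ?_⟩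
        rcases h7 with h7 | ⟨i, hi, h7⟩
        · left
          simp only [LinearMap.sub_apply, LinearMap.smul_apply, End.one_apply, sub_eq_zero] at h7 hu
          rw [hu, ← sub_eq_zero, ← sub_smul] at h7
          exact (smul_eq_zero.1 h7).resolve_left (sub_ne_zero.2 hJ)
        · exact Or.inr ⟨i, by omega, h7⟩
    exact ⟨by simpa [sub_eq_zero] using h8.1, h8.2⟩

/-- This is the Casimir element, written so that it acts as `ν² + 2ν` on a vector of weight `ν`
killed by `e`. -/
lemma commute_casimir : ∀ x ∈ ({h, e} : Set (End K M)),
    Commute (h * h + (2 : K) • h + (4 : K) • (f * e)) x := by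
  have h1 : e * f = f * e + h := by rw [← t.ef]; abel
  have h2 : h * f = f * h - (2 : K) • f := by rw [sub_eq_add_neg, ← t.hf]; abel
  have h3 : h * e = e * h + (2 : K) • e := by rw [← t.he]; abel
  rintro x (rfl | rfl)
  · have : x * (f * e) = (f * e) * x := by
      rw [← mul_assoc, h2, sub_mul, mul_assoc, h3]
      simp only [mul_add, smul_mul_assoc, mul_smul_comm, mul_assoc]
      abel
    simp only [Commute, SemiconjBy, add_mul, mul_add, smul_mul_assoc, mul_smul_comm, this,
      mul_assoc]
  · have e1 : x * (h * h) = h * h * x - (4 : K) • (h * x) + (4 : K) • x := by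
      have : x * h = h * x - (2 : K) • x := by rw [h3]; abel
      rw [← mul_assoc, this, sub_mul, mul_assoc, this]
      simp only [mul_sub, smul_mul_assoc, mul_smul_comm, mul_assoc, this, smul_sub]
      module
    have e2 : x * (f * x) = f * x * x + h * x := by rw [← mul_assoc, h1, add_mul]
    have e3 : x * h = h * x - (2 : K) • x := by rw [h3]; abel
    simp only [Commute, SemiconjBy, add_mul, mul_add, smul_mul_assoc, mul_smul_comm, e1, e2, e3]
    module

lemma exists_pow_ne_zero [CharZero K] [FiniteDimensional K M] {u : M} (hu : u ≠ 0) :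
    ∃ k, (e ^ k) u ≠ 0 ∧ e ((e ^ k) u) = 0 := by
  classical
  obtain ⟨N, hN⟩ := isNilpotent_of_mul_sub_mul_eq_smul two_ne_zero t.he
  have hex : ∃ k, (e ^ k) u = 0 := ⟨N, by simp [hN]⟩
  obtain ⟨k, h1, h2⟩ := Nat.exists_not_and_succ_of_not_zero_of_exists (p := fun k => (e ^ k) u = 0)
    (by simpa using hu) hex
  exact ⟨k, h1, by rw [← End.mul_apply, ← pow_succ']; exact h2⟩

/-- In a finite dimensional representation of `𝔰𝔩₂`, the element `h` acts semisimply. -/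
theorem isSemisimple [IsAlgClosed K] [CharZero K] [FiniteDimensional K M] : h.IsSemisimple := by
  set c : End K M := h * h + (2 : K) • h + (4 : K) • (f * e) with hc
  have hch : Commute c h := t.commute_casimir h (by simp)
  have hce : Commute c e := t.commute_casimir e (by simp)
  obtain ⟨N, hN⟩ : IsNilpotent f := isNilpotent_of_mul_sub_mul_eq_smul (c := -2) (by simp)
    (by rw [t.hf, neg_smul])
  have keyc : ∀ {w : M} {γ ν : K}, w ∈ c.maxGenEigenspace γ → w ∈ h.maxGenEigenspace ν → w ≠ 0 →
      e w = 0 → γ = ν * ν + 2 * ν ∧ ∃ i : ℕ, ν = i := by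
    intro w γ ν hwc hwh hw0 hew
    obtain ⟨h1, h2⟩ := t.of_e_eq_zero N hwh hew (by simp [hN])
    obtain ⟨i, -, hi⟩ := h2.resolve_left hw0
    refine ⟨?_, i, hi⟩
    have h3 : c w = (ν * ν + 2 * ν) • w := by
      simp only [hc, LinearMap.add_apply, End.mul_apply, LinearMap.smul_apply, h1, map_smul, hew,
        map_zero, smul_zero, add_zero, smul_smul, ← add_smul]
    obtain ⟨m, hm⟩ := (End.mem_maxGenEigenspace _ _ _).1 hwc
    have hpow : ∀ l : ℕ, ((c - γ • 1) ^ l) w = (ν * ν + 2 * ν - γ) ^ l • w := by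
      intro l
      induction l with
      | zero => simp
      | succ l ihl =>
        rw [pow_succ', End.mul_apply, ihl, map_smul, pow_succ, mul_smul]
        simp only [LinearMap.sub_apply, LinearMap.smul_apply, End.one_apply, h3, sub_smul]
    rw [hpow] at hm
    have h5 := (smul_eq_zero.1 hm).resolve_right hw0
    exact (sub_eq_zero.1 (eq_zero_of_pow_eq_zero h5)).symm
  have hcmem : ∀ {v : M} {γ : K} (x : End K M), Commute c x → v ∈ c.maxGenEigenspace γ →
      x v ∈ c.maxGenEigenspace γ := by
    intro v γ x hx hv
    rw [End.mem_maxGenEigenspace] at hv ⊢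
    obtain ⟨m, hm⟩ := hv
    refine ⟨m, ?_⟩
    have hx' : Commute (c - γ • 1) x := hx.sub_left ((Commute.one_left x).smul_left γ)
    rw [← End.mul_apply, (hx'.pow_left m).eq, End.mul_apply, hm, map_zero]
  have main : ∀ {v : M} {γ ν : K}, v ∈ c.maxGenEigenspace γ → v ∈ h.maxGenEigenspace ν →
      h v = ν • v := by
    intro v γ ν hvc hvh
    have hxh : ∀ ν : K, Commute c (h - ν • 1) := fun ν =>
      hch.sub_right ((Commute.one_right c).smul_right ν)
    -- Raise `u = (h - ν) v` to a nonzero highest weight vector `e^k u`, of weight `i`. If `e^(k+1)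
    -- v = 0`, then `h` acts on `e^k v` by a scalar and `e^k u = 0`. Otherwise `e^(k+1) v` rises to
    -- a highest weight `j > i` with the same Casimir value, but `i² + 2i = j² + 2j` is impossible
    -- for distinct naturals.
    by_contra hne
    set u := (h - ν • 1) v with hu
    have hu0 : u ≠ 0 := by simpa [hu, sub_eq_zero] using hne
    obtain ⟨k, hk1, hk2⟩ := t.exists_pow_ne_zero hu0
    have huh : u ∈ h.maxGenEigenspace ν := by
      obtain ⟨m, hm⟩ := (End.mem_maxGenEigenspace _ _ _).1 hvh
      refine (End.mem_maxGenEigenspace _ _ _).2 ⟨m, ?_⟩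
      rw [hu, ← End.mul_apply, ← pow_succ, pow_succ', End.mul_apply, hm, map_zero]
    obtain ⟨g1, i, g2⟩ := keyc (hcmem _ (hce.pow_right k) (hcmem _ (hxh ν) hvc))
      (t.e_pow_mem huh k) hk1 hk2
    by_cases hev : (e ^ (k + 1)) v = 0
    · have hev' : e ((e ^ k) v) = 0 := by rwa [pow_succ'] at hev
      have h1 := (t.of_e_eq_zero N (t.e_pow_mem hvh k) hev' (by simp [hN])).1
      apply hk1
      have hs : SemiconjBy (e ^ k) (h - ν • 1) (h - (ν + 2 * k) • 1) := by
        clear * - t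
        induction k with
        | zero => simp [SemiconjBy]
        | succ k ih =>
          rw [pow_succ']
          have := (t.semiconj_e (ν + 2 * k)).mul_left ih
          have e1 : ν + 2 * ((k + 1 : ℕ) : K) = ν + 2 * k + 2 := by push_cast; ring
          rwa [e1]
      rw [hu, ← End.mul_apply, hs.eq, End.mul_apply]
      simp [h1]
    · obtain ⟨l, hl1, hl2⟩ := t.exists_pow_ne_zero hev
      rw [← End.mul_apply (e ^ l), ← pow_add] at hl1 hl2
      obtain ⟨g3, j, g4⟩ := keyc (hcmem _ (hce.pow_right _) hvc) (t.e_pow_mem hvh _) hl1 hl2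
      rw [g2] at g1
      rw [g4] at g3
      have hij : (i : K) + 2 * (l + 1) = j := by
        rw [← g2, ← g4]; push_cast; ring
      have hij' : i + 2 * (l + 1) = j := by exact_mod_cast hij
      have hq : i * i + 2 * i = j * j + 2 * j := by exact_mod_cast g1.symm.trans g3
      subst hij'
      nlinarith
  apply isSemisimple_of_iSup_eigenspace_eq_top
  have htop := End.iSup_iInf_maxGenEigenspace_eq_top_of_iSup_maxGenEigenspace_eq_top_of_commute
    (f := fun b : Bool => cond b c h) ?_ ?_
  · rw [eq_top_iff, ← htop, iSup_le_iff]
    intro χ v hv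
    rw [Submodule.mem_iInf] at hv
    exact Submodule.mem_iSup_of_mem (χ false)
      (End.mem_eigenspace_iff.2 (main (hv true) (hv false)))
  · rintro (_ | _) (_ | _) hne
    exacts [absurd rfl hne, hch.symm, hch, absurd rfl hne]
  · intro b
    exact End.iSup_maxGenEigenspace_eq_top _

end IsSl2Action

end Semisimple

/-! ### Semisimple elements in representations of semisimple Lie algebras -/

section Semisimple

open Module LieAlgebra LieModule
open scoped TensorProduct

variable {K L M : Type*} [Field K] [LieRing L] [LieAlgebra K L]
  [AddCommGroup M] [Module K M] [LieRingModule L M] [LieModule K L M]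

lemma isSl2Action_toEnd {h e f : L} (t : IsSl2Triple h e f) :
    IsSl2Action (toEnd K L M h) (toEnd K L M e) (toEnd K L M f) where
  he := LinearMap.ext fun m => by
    simp only [LinearMap.sub_apply, End.mul_apply, toEnd_apply_apply, LinearMap.smul_apply]
    rw [← lie_lie, t.lie_h_e_smul K, smul_lie]
  hf := LinearMap.ext fun m => by
    simp only [LinearMap.sub_apply, End.mul_apply, toEnd_apply_apply, LinearMap.smul_apply,
      LinearMap.neg_apply]
    rw [← lie_lie, t.lie_lie_smul_f K, neg_lie, smul_lie]
  ef := LinearMap.ext fun m => by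
    simp only [LinearMap.sub_apply, End.mul_apply, toEnd_apply_apply]
    rw [← lie_lie, t.lie_e_f]

/-- An element with semisimple adjoint action is contained in a Cartan subalgebra. -/
lemma exists_isCartanSubalgebra_mem [Infinite K] [FiniteDimensional K L] {x : L}
    (hx : (ad K L x).IsSemisimple) : ∃ H : LieSubalgebra K L, H.IsCartanSubalgebra ∧ x ∈ H := by
  -- As `ad x` is semisimple, `C` is the centralizer of `x`. A Cartan subalgebra of `C` contains the
  -- central element `x` and turns out to be one of `L`.
  set C := LieSubalgebra.engel K x with hC
  have hCx : ∀ y ∈ C, ⁅x, y⁆ = 0 := by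
    intro y hy
    rw [LieSubalgebra.mem_engel_iff] at hy
    obtain ⟨n, hn⟩ := hy
    have h1 : y ∈ (ad K L x).maxGenEigenspace 0 :=
      (End.mem_maxGenEigenspace _ _ _).2 ⟨n, by simpa using hn⟩
    rw [(End.isFinitelySemisimple_iff_isSemisimple.2 hx).maxGenEigenspace_eq_eigenspace,
      End.mem_eigenspace_iff] at h1
    simpa using h1
  obtain ⟨y, hy⟩ := exists_isCartanSubalgebra_engel K C
  have hxC : x ∈ C := LieSubalgebra.self_mem_engel K x
  have hxy : (⟨x, hxC⟩ : C) ∈ LieSubalgebra.engel K y := by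
    rw [LieSubalgebra.mem_engel_iff]
    refine ⟨1, Subtype.ext ?_⟩
    simp [← lie_skew y.1 x, hCx y.1 y.2]
  refine ⟨(LieSubalgebra.engel K y).map C.incl, ⟨?_, ?_⟩, ?_⟩
  · have := hy.nilpotent
    let φ : LieSubalgebra.engel K y →ₗ⁅K⁆ (LieSubalgebra.engel K y).map C.incl :=
      { toFun := fun z => ⟨C.incl z.1, ⟨z.1, z.2, rfl⟩⟩
        map_add' := fun _ _ => rfl
        map_smul' := fun _ _ => rfl
        map_lie' := rfl }
    have hφ : Function.Surjective φ := by
      rintro ⟨_, z, hz, rfl⟩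
      exact ⟨⟨z, hz⟩, rfl⟩
    exact hφ.lieAlgebra_isNilpotent
  · refine le_antisymm (fun z hz => ?_) (LieSubalgebra.le_normalizer _)
    rw [LieSubalgebra.mem_normalizer_iff] at hz
    have hzC : z ∈ C := by
      obtain ⟨w, -, hw⟩ := hz x ⟨_, hxy, rfl⟩
      rw [LieSubalgebra.mem_engel_iff]
      refine ⟨2, ?_⟩
      have h1 : ⁅x, z⁆ = -w.1 := by rw [← lie_skew]; exact congrArg Neg.neg hw.symm
      rw [pow_two, Module.End.mul_apply, ad_apply, ad_apply, h1, lie_neg, hCx _ w.2, neg_zero]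
    have hzn : (⟨z, hzC⟩ : C) ∈ (LieSubalgebra.engel K y).normalizer := by
      rw [LieSubalgebra.mem_normalizer_iff]
      intro v hv
      obtain ⟨w, hw, hwv⟩ := hz v ⟨v, hv, rfl⟩
      have : w = ⁅(⟨z, hzC⟩ : C), v⁆ := Subtype.ext hwv
      rwa [← this]
    rw [hy.self_normalizing] at hzn
    exact ⟨_, hzn, rfl⟩
  · exact ⟨_, hxy, rfl⟩

/-- In a representation of a semisimple Lie algebra, elements with semisimple adjoint action act
semisimply. -/
theorem isSemisimple_toEnd_of_isSemisimple_ad [IsAlgClosed K] [CharZero K] [FiniteDimensional K L]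
    [IsKilling K L] [FiniteDimensional K M] {x : L} (hx : (ad K L x).IsSemisimple) :
    (toEnd K L M x).IsSemisimple := by
  have : Infinite K := IsAlgClosed.instInfinite
  obtain ⟨H, hH, hxH⟩ := exists_isCartanSubalgebra_mem hx
  suffices ∀ y : H, (toEnd K L M y).IsSemisimple from this ⟨x, hxH⟩
  intro y
  -- Coroots span the Cartan subalgebra, each is the `h` of an `𝔰𝔩₂` triple, and commuting
  -- semisimple maps have semisimple sums.
  have hy : y ∈ Submodule.span K (Set.range (IsKilling.rootSystem H).coroot) := by
    rw [RootPairing.IsRootSystem.span_coroot_eq_top]; trivial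
  induction hy using Submodule.span_induction with
  | mem y hy =>
    obtain ⟨α, rfl⟩ := hy
    have hα : α.1.IsNonZero := by
      exact (Finset.mem_filter.1 α.2).2
    obtain ⟨h, e, f, t, he, hf⟩ := IsKilling.exists_isSl2Triple_of_weight_isNonZero hα
    rw [IsKilling.rootSystem_coroot_apply, ← t.h_eq_coroot hα he hf]
    exact (isSl2Action_toEnd t).isSemisimple
  | zero => simp
  | add y z _ _ hy hz =>
    rw [show ((y + z : H) : L) = y + z from rfl, map_add]
    refine Module.End.IsSemisimple.add_of_commute ?_ hy hz
    have h1 : ⁅y, z⁆ = 0 := trivial_lie_zero _ _ _ _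
    have h2 : ⁅(y : L), (z : L)⁆ = 0 := congrArg Subtype.val h1
    refine LinearMap.ext fun m => ?_
    simp only [End.mul_apply, toEnd_apply_apply]
    rw [← sub_eq_zero, ← lie_lie, h2, zero_lie]
  | smul c y _ hy =>
    rw [show ((c • y : H) : L) = c • (y : L) from rfl, map_smul]
    exact Module.End.IsSemisimple_smul c hy

lemma iSup_eigenspace_baseChange_eq_top (A : Type*) [Field A] [Algebra K A] {T : End K M}
    (h : ⨆ μ, T.eigenspace μ = ⊤) :
    ⨆ μ, End.eigenspace (T.baseChange A) μ = ⊤ := by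
  rw [eq_top_iff]
  rintro v -
  induction v with
  | zero => exact zero_mem _
  | add v w hv hw => exact add_mem hv hw
  | tmul a m =>
    have hm : m ∈ ⨆ μ, T.eigenspace μ := h ▸ Submodule.mem_top
    induction hm using Submodule.iSup_induction' with
    | zero => simp
    | add x y _ _ hx hy => rw [TensorProduct.tmul_add]; exact add_mem hx hy
    | mem μ x hx =>
      refine Submodule.mem_iSup_of_mem (algebraMap K A μ) ?_
      rw [End.mem_eigenspace_iff] at hx ⊢
      rw [LinearMap.baseChange_tmul, hx, TensorProduct.tmul_smul, algebraMap_smul]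

lemma isKilling_baseChange [FiniteDimensional K L] (A : Type*) [Field A] [Algebra K A]
    [IsKilling K L] : IsKilling A (A ⊗[K] L) where
  killingCompl_top_eq_bot := by
    rw [LieSubmodule.eq_bot_iff]
    intro v hv
    rw [LieIdeal.mem_killingCompl] at hv
    have hB : LinearMap.BilinForm.Nondegenerate (killingForm K L) :=
      IsKilling.killingForm_nondegenerate K L
    let b := Module.finBasis K L
    let b' := LinearMap.BilinForm.dualBasis (killingForm K L) hB b
    have hform : killingForm A (A ⊗[K] L) = (killingForm K L).baseChange A :=
      LieModule.traceForm_baseChange (R := K) (L := L) (M := L) A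
    rw [← (b.baseChange A).sum_repr v]
    refine Finset.sum_eq_zero fun i _ => ?_
    have h1 := hv (1 ⊗ₜ b' i) (LieSubmodule.mem_top _)
    rw [hform, ← (b.baseChange A).sum_repr v, map_sum] at h1
    simp only [map_smul, Basis.baseChange_apply, smul_eq_mul] at h1
    rw [Finset.sum_eq_single i] at h1
    · have h2 : (killingForm K L) (b' i) (b i) = 1 := by
        simp [b', LinearMap.BilinForm.apply_dualBasis_left]
      rw [LinearMap.BilinForm.baseChange_tmul, h2] at h1
      simp at h1
      rw [h1, zero_smul]
    · intro j _ hj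
      have h2 : (killingForm K L) (b' i) (b j) = 0 := by
        simp [b', LinearMap.BilinForm.apply_dualBasis_left, hj]
      rw [LinearMap.BilinForm.baseChange_tmul, h2]
      simp
    · simp

/-- A version of `isSemisimple_toEnd_of_isSemisimple_ad` over a field that is not closed. -/
theorem isSemisimple_baseChange_toEnd (A : Type*) [Field A] [Algebra K A] [IsAlgClosed A]
    [CharZero A] [FiniteDimensional K L] [IsKilling K L] [FiniteDimensional K M] {x : L}
    (hx : ⨆ μ, (ad K L x).eigenspace μ = ⊤) :
    End.IsSemisimple ((toEnd K L M x).baseChange A) := by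
  have := isKilling_baseChange (K := K) (L := L) A
  rw [← LieModule.toEnd_baseChange]
  apply isSemisimple_toEnd_of_isSemisimple_ad
  apply isSemisimple_of_iSup_eigenspace_eq_top
  have := iSup_eigenspace_baseChange_eq_top A hx
  change ⨆ μ, End.eigenspace ((toEnd K L L x).baseChange A) μ = ⊤ at this
  rwa [← LieModule.toEnd_baseChange] at this

end Semisimple

/-! ### Nilpotency of the action of the radical intersected with the derived algebra -/

section Nilpotent

open Module LieAlgebra LieModule
open scoped TensorProduct

lemma isNilpotent_of_restrict_of_mapQ {K M : Type*} [Field K] [AddCommGroup M] [Module K M]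
    {T : End K M} {N : Submodule K M} {a b : ℕ} (h1 : ∀ m ∈ N, (T ^ a) m = 0)
    (h2 : ∀ m, (T ^ b) m ∈ N) : IsNilpotent T :=
  ⟨a + b, LinearMap.ext fun m => by rw [pow_add, End.mul_apply, h1 _ (h2 m)]; rfl⟩

/-- In a finite dimensional representation, the elements of the derived algebra that lie in a
solvable ideal act nilpotently. -/
theorem isNilpotent_toEnd_of_mem_solvable {K L M : Type*} [Field K] [IsAlgClosed K] [CharZero K]
    [LieRing L] [LieAlgebra K L] [AddCommGroup M] [Module K M] [LieRingModule L M] [LieModule K L M]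
    [FiniteDimensional K M] (I : LieIdeal K L) [IsSolvable I] {x : L} (hxI : x ∈ I)
    (hx : x ∈ derivedSeries K L 1) : IsNilpotent (toEnd K L M x) := by
  induction hd : finrank K M using Nat.strong_induction_on generalizing M with
  | _ d ih =>
  -- A proper nonzero submodule reduces the claim to it and its quotient. In the irreducible case
  -- Lie's theorem gives a weight of `I`; its weight space is an `L`-submodule, hence everything. So
  -- `x` acts as a scalar, of trace zero because `x ∈ [L, L]`.
  by_cases hirr : ∃ N : LieSubmodule K L M, N ≠ ⊥ ∧ N ≠ ⊤
  · obtain ⟨N, hN0, hN1⟩ := hirr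
    have hlt : finrank K N < d := by
      rw [← hd]
      exact Submodule.finrank_lt (s := N.toSubmodule) (by
        rwa [Ne, LieSubmodule.toSubmodule_eq_top])
    have hlt' : finrank K (M ⧸ N) < d := by
      rw [← hd]
      have h1 := Submodule.finrank_quotient_add_finrank N.toSubmodule
      have h2 : finrank K N ≠ 0 := fun h0 => hN0 (by
        rw [← LieSubmodule.toSubmodule_eq_bot]
        exact Submodule.finrank_eq_zero.1 h0)
      change finrank K (M ⧸ N.toSubmodule) < _
      change finrank K N.toSubmodule ≠ 0 at h2
      omega
    obtain ⟨a, ha⟩ := ih _ hlt (M := N) rfl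
    obtain ⟨b, hb⟩ := ih _ hlt' (M := M ⧸ N) rfl
    refine isNilpotent_of_restrict_of_mapQ (N := N.toSubmodule) (a := a) (b := b) ?_ ?_
    · intro m hm
      have h1 : ∀ l : ℕ, (((toEnd K L N x) ^ l) ⟨m, hm⟩ : M) = ((toEnd K L M x) ^ l) m := by
        intro l
        induction l with
        | zero => rfl
        | succ l ihl => rw [pow_succ', pow_succ', End.mul_apply, End.mul_apply, ← ihl]; rfl
      rw [← h1, ha]; rfl
    · intro m
      have h1 : ∀ l : ℕ, ((toEnd K L (M ⧸ N) x) ^ l) (LieSubmodule.Quotient.mk m) =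
          LieSubmodule.Quotient.mk (N := N) (((toEnd K L M x) ^ l) m) := by
        intro l
        induction l with
        | zero => rfl
        | succ l ihl => rw [pow_succ', pow_succ', End.mul_apply, End.mul_apply, ihl]; rfl
      have h2 := h1 b
      rw [hb] at h2
      exact (LieSubmodule.Quotient.mk_eq_zero').1 h2.symm
  · push Not at hirr
    rcases subsingleton_or_nontrivial M with hM | hM
    · exact ⟨1, LinearMap.ext fun m => Subsingleton.elim _ _⟩
    obtain ⟨χ, hχ⟩ : ∃ χ : Module.Dual K I, Nontrivial (weightSpace M χ) :=
      exists_nontrivial_weightSpace_of_isSolvable K I M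
    let N : LieSubmodule K L M := weightSpaceOfIsLieTower K M χ
    replace hχ : Nontrivial N := hχ
    have hN : N = ⊤ := hirr N (by rwa [← LieSubmodule.nontrivial_iff_ne_bot K L M])
    have hact : toEnd K L M x = χ ⟨x, hxI⟩ • LinearMap.id := by
      ext m
      have hm : ∀ (y : L) (hy : y ∈ I), ⁅y, m⁆ = χ ⟨y, hy⟩ • m := by
        simpa [N, weightSpaceOfIsLieTower, mem_weightSpace] using
          (hN ▸ LieSubmodule.mem_top _ : m ∈ N)
      simpa using hm x hxI
    have htr : LinearMap.trace K M (toEnd K L M x) = 0 := by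
      replace hx : x ∈ Submodule.span K {⁅u, v⁆ | (u : L) (v : L)} := by
        rw [← LieAlgebra.coe_derivedSeries_one_eq]; exact hx
      clear hact ih hxI
      induction hx using Submodule.span_induction with
      | mem u hu => obtain ⟨a, b, rfl⟩ := hu; simp
      | zero => simp
      | add a b _ _ ha hb => rw [map_add, map_add, ha, hb, add_zero]
      | smul c a _ ha => rw [map_smul, map_smul, ha, smul_zero]
    rw [hact, map_smul, LinearMap.trace_id, smul_eq_mul, mul_eq_zero] at htr
    rw [hact, htr.resolve_right (Nat.cast_ne_zero.2 finrank_pos.ne'), zero_smul]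
    exact IsNilpotent.zero

/-- Descent from an algebraically closed extension: it suffices that the base change of the radical
is a solvable ideal, and nilpotency descends because base change of endomorphisms is injective. -/
theorem isNilpotent_toEnd_of_mem_radical {K L M : Type*} (A : Type*) [Field K] [Field A]
    [Algebra K A] [IsAlgClosed A] [CharZero A]
    [LieRing L] [LieAlgebra K L] [AddCommGroup M] [Module K M] [LieRingModule L M] [LieModule K L M]
    [FiniteDimensional K M] [FiniteDimensional K L] {x : L} (hxI : x ∈ radical K L)
    (hx : x ∈ derivedSeries K L 1) : IsNilpotent (toEnd K L M x) := by
  have hsol : IsSolvable ((radical K L).baseChange A) := by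
    obtain ⟨k, hk⟩ := (isSolvable_iff K (radical K L)).1 inferInstance
    rw [LieIdeal.derivedSeries_eq_bot_iff] at hk
    rw [isSolvable_iff A]
    refine ⟨k, ?_⟩
    rw [LieIdeal.derivedSeries_eq_bot_iff, derivedSeriesOfIdeal_baseChange, hk,
      LieSubmodule.baseChange_bot]
  have h1 : (1 ⊗ₜ[K] x : A ⊗[K] L) ∈ (radical K L).baseChange A :=
    Submodule.tmul_mem_baseChange_of_mem 1 hxI
  have h2 : (1 ⊗ₜ[K] x : A ⊗[K] L) ∈ derivedSeries A (A ⊗[K] L) 1 := by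
    rw [derivedSeries_baseChange]
    exact Submodule.tmul_mem_baseChange_of_mem 1 hx
  have h3 := isNilpotent_toEnd_of_mem_solvable (M := A ⊗[K] M) _ h1 h2
  rw [LieModule.toEnd_baseChange] at h3
  exact (IsNilpotent.map_iff (f := End.baseChangeHom K A M)
    (LinearMap.baseChangeHom_injective K M A)).1 h3

end Nilpotent

/-! ### The radical component of the characteristic element -/

section Grading

variable {g : Type u} [LieRing g] [LieAlgebra ℝ g] {𝒜 : ℤ → Submodule ℝ g}

open Module LieAlgebra LieModule
open scoped TensorProduct

/-- The projections onto the homogeneous components. -/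
lemma IsLieGrading.exists_proj (hG : IsLieGrading 𝒜) : ∃ π : ℤ → g →ₗ[ℝ] g,
    (∀ p X, π p X ∈ 𝒜 p) ∧ (∀ p, ∀ X ∈ 𝒜 p, π p X = X) ∧
    (∀ p q, q ≠ p → ∀ X ∈ 𝒜 q, π p X = 0) ∧ ∀ X, (∀ p, π p X = 0) → X = 0 := by
  classical
  let _ := hG.isInternal.chooseDecomposition
  refine ⟨fun p => (𝒜 p).subtype ∘ₗ DirectSum.component ℝ ℤ (fun i => 𝒜 i) p ∘ₗ
    (DirectSum.decomposeLinearEquiv 𝒜).toLinearMap, ?_, ?_, ?_, ?_⟩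
  · intro p X
    exact Subtype.property _
  · intro p X hX
    exact DirectSum.decompose_of_mem_same 𝒜 hX
  · intro p q hpq X hX
    exact DirectSum.decompose_of_mem_ne 𝒜 hX hpq
  · intro X hX
    apply (DirectSum.decompose 𝒜).injective
    rw [DirectSum.decompose_zero]
    ext p
    exact hX p

lemma IsLieGrading.induction (hG : IsLieGrading 𝒜) {motive : g → Prop}
    (mem : ∀ p, ∀ X ∈ 𝒜 p, motive X) (add : ∀ X Y, motive X → motive Y → motive (X + Y)) (X : g) :
    motive X := by
  have hX : X ∈ ⨆ p, 𝒜 p := hG.isInternal.submodule_iSup_eq_top ▸ Submodule.mem_top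
  induction hX using Submodule.iSup_induction' with
  | mem p x hx => exact mem p x hx
  | zero => exact mem 0 0 (zero_mem _)
  | add x y _ _ hx hy => exact add x y hx hy

lemma IsCharacteristicElement.mem_of_lie_eq_zero (hG : IsLieGrading 𝒜) {E : g}
    (hE : IsCharacteristicElement 𝒜 E) {X : g} (hX : ⁅E, X⁆ = 0) : X ∈ 𝒜 0 := by
  obtain ⟨π, h1, h2, h3, h4⟩ := hG.exists_proj
  have hπ : ∀ p X, π p ⁅E, X⁆ = (p : ℝ) • π p X := by
    intro p X
    induction X using hG.induction with
    | mem q Y hY =>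
      rw [hE.2 q Y hY, map_smul]
      by_cases hqp : q = p
      · rw [hqp]
      · rw [h3 p q hqp Y hY, smul_zero, smul_zero]
    | add Y Z hY hZ =>
      rw [lie_add, map_add, map_add, hY, hZ, smul_add]
  have h5 : X - π 0 X = 0 := by
    apply h4
    intro p
    rw [map_sub, sub_eq_zero]
    by_cases hp : p = 0
    · rw [hp, h2 0 _ (h1 0 X)]
    · rw [h3 p 0 (Ne.symm hp) _ (h1 0 X)]
      have := hπ p X
      rw [hX, map_zero] at this
      exact (smul_eq_zero.1 this.symm).resolve_left (by exact_mod_cast hp)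
  rw [sub_eq_zero.1 h5]
  exact h1 0 X

variable {n k : ℕ} {i₁ : (Fin n → ℂ) →ₗ[ℝ] g}

/-- By invariance, the Killing complement of `[L, L]` is central, hence zero. -/
lemma derivedSeries_one_eq_top (K L : Type*) [Field K] [LieRing L] [LieAlgebra K L]
    [FiniteDimensional K L] [IsKilling K L] : derivedSeries K L 1 = ⊤ := by
  have h := LieIdeal.isCompl_killingCompl (derivedSeries K L 1)
  suffices LieIdeal.killingCompl K L (derivedSeries K L 1) = ⊥ by
    rw [← h.sup_eq_top, this, sup_bot_eq]
  rw [LieSubmodule.eq_bot_iff]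
  intro x hx
  rw [LieIdeal.mem_killingCompl] at hx
  have hc : ∀ y : L, ⁅x, y⁆ = 0 := by
    intro y
    refine (IsKilling.killingForm_nondegenerate K L).1 _ fun z => ?_
    change LieModule.traceForm K L L ⁅x, y⁆ z = 0
    rw [LieModule.traceForm_apply_lie_apply, LieModule.traceForm_comm]
    exact hx _ (LieSubmodule.lie_mem_lie (LieSubmodule.mem_top y) (LieSubmodule.mem_top z))
  have hx' : x ∈ center K L := (LieModule.mem_maxTrivSubmodule K L L x).2 fun y => by
    rw [← lie_skew, hc, neg_zero]
  rwa [center_eq_bot, LieSubmodule.mem_bot] at hx'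

lemma sub_eq_zero_of_isNilpotent_of_isSemisimple_baseChange {K V : Type*} (A : Type*) [Field K]
    [PerfectField K] [Field A] [PerfectField A] [Algebra K A] [AddCommGroup V] [Module K V]
    [FiniteDimensional K V] {S T : End K V} (hST : Commute S T)
    (hS : End.IsSemisimple (S.baseChange A)) (hT : End.IsSemisimple (T.baseChange A))
    (hn : _root_.IsNilpotent (S - T)) : S - T = 0 := by
  have hcomm : Commute (End.baseChangeHom K A V S) (End.baseChangeHom K A V T) := hST.map _
  have hzero : End.baseChangeHom K A V (S - T) = 0 := by
    refine End.eq_zero_of_isNilpotent_isSemisimple (hn.map _) ?_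
    rw [map_sub]
    exact End.IsSemisimple.sub_of_commute hcomm hS hT
  exact LinearMap.baseChangeHom_injective K V A (hzero.trans (map_zero _).symm)

/-- If the characteristic element lies in the derived algebra, its component in the radical
vanishes for every graded Levi decomposition. -/
theorem radical_component_eq_zero [Module.Finite ℝ g] (hG : IsLieGrading 𝒜) (hT : IsTransitive 𝒜)
    {E : g} (hE : IsCharacteristicElement 𝒜 E) {s : LieSubalgebra ℝ g}
    (hs : IsPseudocomplexGradedLevi 𝒜 i₁ s) (hder : E ∈ derivedSeries ℝ g 1)
    {Es Er : g} (hEs : Es ∈ s) (hEr : Er ∈ radical ℝ g) (hsum : E = Es + Er) : Er = 0 := by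
  have hsr : ∀ X ∈ s, X ∈ radical ℝ g → X = 0 := fun X h1 h2 =>
    (Submodule.disjoint_def.1 hs.isCompl.disjoint) X h1 h2
  -- Compare components in `p x = [E_𝔰, x] + [E_𝔯, x]`: the second bracket lies in the radical, the
  -- rest in `𝔰`.
  have hhom : ∀ (p : ℤ), ∀ x ∈ s, x ∈ 𝒜 p → ⁅Er, x⁆ = 0 ∧ ⁅Es, x⁆ = (p : ℝ) • x := by
    intro p x hxs hxp
    have h1 := hE.2 p x hxp
    rw [hsum, add_lie] at h1
    have h2 : ⁅Er, x⁆ = 0 := by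
      apply hsr
      · rw [← eq_sub_iff_add_eq'] at h1
        rw [h1]
        exact sub_mem (s.smul_mem _ hxs) (s.lie_mem hEs hxs)
      · exact lie_mem_left ℝ g (radical ℝ g) _ _ hEr
    exact ⟨h2, by rw [← h1, h2, add_zero]⟩
  have hcent : ∀ x ∈ s, ⁅Er, x⁆ = 0 := by
    intro x hx
    have hx' : x ∈ ⨆ p : ℤ, s.toSubmodule ⊓ 𝒜 p := hs.graded ▸ hx
    induction hx' using Submodule.iSup_induction' with
    | mem p y hy => exact (hhom p y hy.1 hy.2).1
    | zero => simp
    | add y z hy hz ihy ihz =>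
      rw [← hs.graded] at hy hz
      rw [lie_add, ihy hy, ihz hz, add_zero]
  have hdiag : ⨆ μ, (ad ℝ s ⟨Es, hEs⟩).eigenspace μ = ⊤ := by
    rw [eq_top_iff]
    rintro ⟨x, hx⟩ -
    have hx' : x ∈ ⨆ p : ℤ, s.toSubmodule ⊓ 𝒜 p := hs.graded ▸ hx
    induction hx' using Submodule.iSup_induction' with
    | mem p y hy =>
      refine Submodule.mem_iSup_of_mem (p : ℝ) (End.mem_eigenspace_iff.2 (Subtype.ext ?_))
      exact (hhom p y hy.1 hy.2).2
    | zero => exact zero_mem _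
    | add y z hy hz ihy ihz =>
      rw [← hs.graded] at hy hz
      exact add_mem (ihy hy) (ihz hz)
  have := hs.semisimple
  have hK : IsKilling ℝ s := inferInstance
  have hss : End.IsSemisimple ((toEnd ℝ s g ⟨Es, hEs⟩).baseChange ℂ) :=
    isSemisimple_baseChange_toEnd ℂ hdiag
  have hEs' : toEnd ℝ s g ⟨Es, hEs⟩ = ad ℝ g Es := LinearMap.ext fun X => rfl
  rw [hEs'] at hss
  have hEss : End.IsSemisimple ((ad ℝ g E).baseChange ℂ) := by
    apply isSemisimple_of_iSup_eigenspace_eq_top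
    apply iSup_eigenspace_baseChange_eq_top
    rw [eq_top_iff, ← hG.isInternal.submodule_iSup_eq_top]
    refine iSup_le fun p X hX => Submodule.mem_iSup_of_mem (p : ℝ) (End.mem_eigenspace_iff.2 ?_)
    exact hE.2 p X hX
  -- `E_𝔰 ∈ 𝔰 = [𝔰, 𝔰]`, so `E_𝔯 = E - E_𝔰` is in the derived algebra of `𝔤`.
  have hder' : Er ∈ derivedSeries ℝ g 1 := by
    have h1 : Es ∈ derivedSeries ℝ g 1 := by
      have h2 : (⟨Es, hEs⟩ : s) ∈ derivedSeries ℝ s 1 := by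
        rw [derivedSeries_one_eq_top]; trivial
      exact LieIdeal.derivedSeries_map_le 1 (LieIdeal.mem_map (f := s.incl) h2)
    rw [eq_sub_of_add_eq' hsum.symm]
    exact sub_mem hder h1
  have hnil : _root_.IsNilpotent (ad ℝ g Er) := isNilpotent_toEnd_of_mem_radical ℂ hEr hder'
  have hsub : ad ℝ g Er = ad ℝ g E - ad ℝ g Es := by
    rw [hsum, map_add, add_sub_cancel_left]
  have hcomm : Commute (ad ℝ g E) (ad ℝ g Es) := by
    refine LinearMap.ext fun X => ?_
    simp only [End.mul_apply, ad_apply]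
    rw [← sub_eq_zero, ← lie_lie, hsum, add_lie, lie_self, hcent Es hEs, add_zero, zero_lie]
  have hz : ad ℝ g Er = 0 := by
    rw [hsub] at hnil ⊢
    exact sub_eq_zero_of_isNilpotent_of_isSemisimple_baseChange ℂ hcomm hEss hss hnil
  have hcen : ∀ X : g, ⁅Er, X⁆ = 0 := fun X => by rw [← ad_apply ℝ, hz]; rfl
  by_contra h0
  -- A central element commutes with `E`, hence has degree zero, where transitivity applies.
  obtain ⟨Y, -, hY⟩ := hT 0 le_rfl Er
    (hE.mem_of_lie_eq_zero hG (by rw [← lie_skew, hcen, neg_zero])) h0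
  exact hY (hcen Y)

end Grading

/-! ### Exponentials and the group `Int(𝔤)` -/

section Exponential

open Module LieAlgebra NormedSpace

variable (g : Type u) [LieRing g] [LieAlgebra ℝ g] [Module.Finite ℝ g]

/-- Coordinates on a finite dimensional Lie algebra. -/
noncomputable def coords : g ≃ₗ[ℝ] (Fin (finrank ℝ g) → ℝ) := (finBasis ℝ g).equivFun

/-- The adjoint representation in coordinates. -/
noncomputable def adCoords : (Fin (finrank ℝ g) → ℝ) →L[ℝ]
    ((Fin (finrank ℝ g) → ℝ) →L[ℝ] (Fin (finrank ℝ g) → ℝ)) :=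
  LinearMap.toContinuousLinearMap
    ((LinearMap.toContinuousLinearMap (𝕜 := ℝ)).toLinearMap ∘ₗ (coords g).conj.toLinearMap ∘ₗ
      (ad ℝ g : g →ₗ[ℝ] End ℝ g) ∘ₗ (coords g).symm.toLinearMap)

variable {g}

lemma adCoords_apply (X Y : g) :
    adCoords g (coords g X) (coords g Y) = coords g ⁅X, Y⁆ := by
  simp [adCoords, LinearEquiv.conj_apply]

lemma adCoords_lie (u w : Fin (finrank ℝ g) → ℝ) :
    adCoords g (adCoords g u w) = adCoords g u * adCoords g w - adCoords g w * adCoords g u := by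
  ext1 z
  obtain ⟨X, rfl⟩ := (coords g).surjective u
  obtain ⟨Y, rfl⟩ := (coords g).surjective w
  obtain ⟨Z, rfl⟩ := (coords g).surjective z
  simp only [adCoords_apply, sub_apply, mul_apply_eq_comp, lie_lie,
    map_sub]

lemma hasSum_coords_iff {ι : Type*} {f : ι → g} {a : g} :
    (letI : TopologicalSpace g := moduleTopology ℝ g; HasSum f a) ↔
      HasSum (fun i => coords g (f i)) (coords g a) := by
  let _ : TopologicalSpace g := moduleTopology ℝ g
  have : IsModuleTopology ℝ g := ⟨rfl⟩
  have : ContinuousAdd g := IsModuleTopology.toContinuousAdd ℝ g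
  have : ContinuousSMul ℝ g := IsModuleTopology.toContinuousSMul ℝ g
  have h1 : Continuous (coords g) :=
    IsModuleTopology.continuous_of_linearMap (coords g).toLinearMap
  have h2 : Continuous (coords g).symm :=
    IsModuleTopology.continuous_of_linearMap (coords g).symm.toLinearMap
  constructor
  · intro h
    exact h.map (coords g).toLinearMap h1
  · intro h
    have := h.map (coords g).symm.toLinearMap h2
    simpa [Function.comp_def] using this

lemma hasSum_exp_adCoords (X Y : g) :
    HasSum (fun m : ℕ => coords g (((m.factorial : ℝ)⁻¹) • ((ad ℝ g X) ^ m) Y))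
      (exp (adCoords g (coords g X)) (coords g Y)) := by
  have h1 := exp_series_hasSum_exp' (𝕂 := ℝ) (adCoords g (coords g X))
  have h2 := h1.map (ContinuousLinearMap.apply ℝ _ (coords g Y)) (map_continuous _)
  have h3 : ∀ m : ℕ, ((adCoords g (coords g X)) ^ m) (coords g Y) =
      coords g (((ad ℝ g X) ^ m) Y) := by
    intro m
    induction m with
    | zero => simp
    | succ m ih =>
      rw [pow_succ', mul_apply_eq_comp, ih, adCoords_apply, pow_succ',
        End.mul_apply, ad_apply]
  simpa [Function.comp_def, h3] using h2

lemma isExpAd_iff {X : g} {A : g ≃ₗ[ℝ] g} :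
    IsExpAd X A ↔ ∀ Y, coords g (A Y) = exp (adCoords g (coords g X)) (coords g Y) := by
  unfold IsExpAd
  refine forall_congr' fun Y => ?_
  rw [hasSum_coords_iff]
  exact ⟨fun h => h.unique (hasSum_exp_adCoords X Y), fun h => h ▸ hasSum_exp_adCoords X Y⟩

lemma exp_mul_exp_neg {B : Type*} [NormedRing B] [NormedAlgebra ℝ B] [CompleteSpace B] (T : B) :
    exp T * exp (-T) = 1 := by
  let _ : NormedAlgebra ℚ B := NormedAlgebra.restrictScalars ℚ ℝ B
  rw [← exp_add_of_commute (Commute.refl T).neg_right, add_neg_cancel, exp_zero]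

lemma exists_isExpAd (X : g) : ∃ A : g ≃ₗ[ℝ] g, IsExpAd X A := by
  set T := adCoords g (coords g X)
  have h1 := exp_mul_exp_neg T
  have h2 := exp_mul_exp_neg (-T)
  rw [neg_neg] at h2
  let e : (Fin (finrank ℝ g) → ℝ) ≃ₗ[ℝ] (Fin (finrank ℝ g) → ℝ) :=
    LinearEquiv.ofLinearMap (exp T).toLinearMap (exp (-T)).toLinearMap
      (LinearMap.ext fun v => congrArg (fun S => S v) h1)
      (LinearMap.ext fun v => congrArg (fun S => S v) h2)
  refine ⟨(coords g).trans (e.trans (coords g).symm), isExpAd_iff.2 fun Y => ?_⟩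
  simp [e, T]

lemma IsExpAd.unique {X : g} {A B : g ≃ₗ[ℝ] g} (hA : IsExpAd X A) (hB : IsExpAd X B) : A = B := by
  ext Y
  apply (coords g).injective
  rw [isExpAd_iff.1 hA, isExpAd_iff.1 hB]

lemma isExpAd_expAd (X : g) : IsExpAd X (expAd X : g ≃ₗ[ℝ] g) := by
  have h : ∃ A : Int g, IsExpAd X (A : g ≃ₗ[ℝ] g) := by
    obtain ⟨A, hA⟩ := exists_isExpAd X
    exact ⟨⟨A, Subgroup.subset_closure ⟨X, hA⟩⟩, hA⟩
  rw [expAd, dif_pos h]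
  exact h.choose_spec

lemma coords_expAd (X Y : g) :
    coords g ((expAd X : g ≃ₗ[ℝ] g) Y) = exp (adCoords g (coords g X)) (coords g Y) :=
  isExpAd_iff.1 (isExpAd_expAd X) Y

lemma IsExpAd.eq_expAd {X : g} {A : Int g} (hA : IsExpAd X (A : g ≃ₗ[ℝ] g)) : A = expAd X :=
  Subtype.ext (hA.unique (isExpAd_expAd X))

lemma expAd_neg (X : g) : expAd (-X) = (expAd X)⁻¹ := by
  rw [eq_inv_iff_mul_eq_one]
  refine Subtype.ext (LinearEquiv.ext fun Y => (coords g).injective ?_)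
  change coords g ((expAd (-X) : g ≃ₗ[ℝ] g) ((expAd X : g ≃ₗ[ℝ] g) Y)) = coords g Y
  rw [coords_expAd, coords_expAd, map_neg, map_neg, ← mul_apply_eq_comp]
  have := exp_mul_exp_neg (-adCoords g (coords g X))
  rw [neg_neg] at this
  rw [this, one_apply_eq_self]

/-- The curve `e^(-tT) Ψ(e^(tT) u) e^(tT)` has zero derivative. With `Ψ = ad` and `T = ad X` this
makes `exp(ad X)` a Lie algebra automorphism. -/
lemma exp_intertwine {V : Type*} [NormedAddCommGroup V] [NormedSpace ℝ V] [CompleteSpace V]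
    (Ψ : V →L[ℝ] V →L[ℝ] V) (T : V →L[ℝ] V) (hT : ∀ u, Ψ (T u) = T * Ψ u - Ψ u * T) (u : V) :
    exp T * Ψ u = Ψ (exp T u) * exp T := by
  let f : ℝ → (V →L[ℝ] V) := fun t => exp (t • (-T)) * Ψ (exp (t • T) u) * exp (t • T)
  have hf : ∀ t, HasDerivAt f 0 t := by
    intro t
    have h1 := hasDerivAt_exp_smul_const (𝕂 := ℝ) (-T) t
    have h2 := hasDerivAt_exp_smul_const' (𝕂 := ℝ) T t
    have h3 : HasDerivAt (fun t : ℝ => Ψ (exp (t • T) u)) (Ψ ((T * exp (t • T)) u)) t :=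
      Ψ.hasFDerivAt.comp_hasDerivAt t
        ((ContinuousLinearMap.apply ℝ V u).hasFDerivAt.comp_hasDerivAt t h2)
    have h4 := (h1.mul h3).mul h2
    refine h4.congr_deriv ?_
    rw [mul_apply_eq_comp, hT, Pi.mul_apply]
    noncomm_ring
  have hconst : f 1 = f 0 :=
    is_const_of_deriv_eq_zero (fun t => (hf t).differentiableAt) (fun t => (hf t).deriv) 1 0
  simp only [f, one_smul, zero_smul, exp_zero, one_mul, mul_one, one_apply_eq_self]
    at hconst
  rw [← hconst, mul_assoc, ← mul_assoc, ← mul_assoc, exp_mul_exp_neg, one_mul]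

lemma expAd_lie (X Y Z : g) : (expAd X : g ≃ₗ[ℝ] g) ⁅Y, Z⁆ =
    ⁅(expAd X : g ≃ₗ[ℝ] g) Y, (expAd X : g ≃ₗ[ℝ] g) Z⁆ := by
  apply (coords g).injective
  rw [← adCoords_apply, coords_expAd, coords_expAd, coords_expAd, ← adCoords_apply]
  exact congrArg (fun S => S (coords g Z)) (exp_intertwine (adCoords g) (adCoords g (coords g X))
    (fun u => adCoords_lie _ _) (coords g Y))

lemma Int.induction {motive : Int g → Prop} (exp : ∀ X, motive (expAd X)) (one : motive 1)
    (mul : ∀ a b, motive a → motive b → motive (a * b)) (a : Int g) : motive a := by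
  obtain ⟨a, ha⟩ := a
  induction ha using Subgroup.closure_induction'' with
  | one => exact one
  | mul x y hx hy ihx ihy => exact mul ⟨x, hx⟩ ⟨y, hy⟩ ihx ihy
  | mem x hx =>
    obtain ⟨X, hX⟩ := hx
    have h1 : (⟨x, Subgroup.subset_closure ⟨X, hX⟩⟩ : Int g) = expAd X :=
      IsExpAd.eq_expAd (A := ⟨x, _⟩) hX
    have h2 := exp X
    rw [← h1] at h2
    exact h2
  | inv_mem x hx =>
    obtain ⟨X, hX⟩ := hx
    have h1 : (⟨x, Subgroup.subset_closure ⟨X, hX⟩⟩ : Int g) = expAd X :=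
      IsExpAd.eq_expAd (A := ⟨x, _⟩) hX
    have h2 := exp (-X)
    rw [expAd_neg, ← h1] at h2
    exact h2

lemma Int.map_lie (a : Int g) (Y Z : g) : (a : g ≃ₗ[ℝ] g) ⁅Y, Z⁆ =
    ⁅(a : g ≃ₗ[ℝ] g) Y, (a : g ≃ₗ[ℝ] g) Z⁆ := by
  induction a using Int.induction generalizing Y Z with
  | exp X => exact expAd_lie X Y Z
  | one => rfl
  | mul a b ha hb =>
    change (a : g ≃ₗ[ℝ] g) ((b : g ≃ₗ[ℝ] g) _) = _
    rw [hb, ha]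
    rfl

lemma Int.mul_expAd_mul_inv (a : Int g) (X : g) :
    a * expAd X * a⁻¹ = expAd ((a : g ≃ₗ[ℝ] g) X) := by
  apply IsExpAd.eq_expAd
  let _ : TopologicalSpace g := moduleTopology ℝ g
  have : IsModuleTopology ℝ g := ⟨rfl⟩
  have : ContinuousAdd g := IsModuleTopology.toContinuousAdd ℝ g
  have : ContinuousSMul ℝ g := IsModuleTopology.toContinuousSMul ℝ g
  intro Y
  have h1 : Continuous (a : g ≃ₗ[ℝ] g) :=
    IsModuleTopology.continuous_of_linearMap (a : g ≃ₗ[ℝ] g).toLinearMap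
  have h2 := (isExpAd_expAd X ((a : g ≃ₗ[ℝ] g).symm Y)).map (a : g ≃ₗ[ℝ] g).toLinearMap h1
  have h3 : ∀ m : ℕ, (ad ℝ g ((a : g ≃ₗ[ℝ] g) X) ^ m) Y =
      (a : g ≃ₗ[ℝ] g) ((ad ℝ g X ^ m) ((a : g ≃ₗ[ℝ] g).symm Y)) := by
    intro m
    induction m with
    | zero => simp
    | succ m ih => rw [pow_succ', End.mul_apply, ih, pow_succ', End.mul_apply, ad_apply, ad_apply,
        Int.map_lie]
  convert h2 using 2 with m
  rw [h3]
  · exact (map_smul (a : g ≃ₗ[ℝ] g) _ _).symm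
  · rfl

lemma isClosed_coords (U : Submodule ℝ g) : IsClosed ((coords g).symm ⁻¹' (U : Set g)) :=
  (U.comap (coords g).symm.toLinearMap).closed_of_finiteDimensional

/-- If `ad X` maps `Z` and the subspace `U` to `U`, then `exp(ad X) Z` is congruent to `Z` modulo
`U`. -/
lemma expAd_sub_mem {U : Submodule ℝ g} {X Z : g} (h1 : ⁅X, Z⁆ ∈ U)
    (h2 : ∀ Y ∈ U, ⁅X, Y⁆ ∈ U) : (expAd X : g ≃ₗ[ℝ] g) Z - Z ∈ U := by
  have h3 := (hasSum_nat_add_iff' 1).2 (hasSum_coords_iff.1 (isExpAd_expAd X Z))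
  have h4 : ∀ m : ℕ, (ad ℝ g X ^ (m + 1)) Z ∈ U := by
    intro m
    induction m with
    | zero => simpa using h1
    | succ m ih => rw [pow_succ', End.mul_apply]; exact h2 _ ih
  have h5 := (isClosed_coords U).mem_of_tendsto h3 (Filter.Eventually.of_forall fun t => by
    simp only [Set.mem_preimage, map_sum, LinearEquiv.symm_apply_apply, SetLike.mem_coe]
    exact sum_mem fun m _ => U.smul_mem _ (h4 m))
  simpa using h5

lemma expAd_mem {U : Submodule ℝ g} {X Z : g} (h : ∀ Y ∈ U, ⁅X, Y⁆ ∈ U) (hZ : Z ∈ U) :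
    (expAd X : g ≃ₗ[ℝ] g) Z ∈ U := by
  simpa using U.add_mem (expAd_sub_mem (h Z hZ) h) hZ

/-- `ad X` maps `𝔤` into `[𝔤, 𝔤]`, so `Int(𝔤)` acts trivially on the abelianization. -/
lemma Int.sub_mem_derivedSeries (a : Int g) (Y : g) :
    (a : g ≃ₗ[ℝ] g) Y - Y ∈ derivedSeries ℝ g 1 := by
  induction a using Int.induction generalizing Y with
  | exp X =>
    have h : ∀ Y : g, ⁅X, Y⁆ ∈ (derivedSeries ℝ g 1).toSubmodule := fun Y =>
      LieSubmodule.lie_mem_lie (LieSubmodule.mem_top X) (LieSubmodule.mem_top Y)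
    exact expAd_sub_mem (U := (derivedSeries ℝ g 1).toSubmodule) (h Y) fun Y _ => h Y
  | one => simp
  | mul a b ha hb =>
    have := add_mem (ha ((b : g ≃ₗ[ℝ] g) Y)) (hb Y)
    rwa [sub_add_sub_cancel] at this

lemma expAd_smul_of_lie_eq {E X : g} {c : ℝ} (h : ⁅E, X⁆ = c • X) (t : ℝ) :
    (expAd (t • E) : g ≃ₗ[ℝ] g) X = Real.exp (t * c) • X := by
  apply (coords g).injective
  refine (hasSum_coords_iff.1 (isExpAd_expAd (t • E) X)).unique ?_
  have h1 : ∀ m : ℕ, (ad ℝ g (t • E) ^ m) X = (t * c) ^ m • X := by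
    intro m
    induction m with
    | zero => simp
    | succ m ih =>
      rw [pow_succ', End.mul_apply, ih, ad_apply, lie_smul, smul_lie, h, smul_smul, smul_smul,
        pow_succ, mul_assoc]
  have h2 := NormedSpace.exp_series_hasSum_exp' (𝕂 := ℝ) (t * c)
  rw [← Real.exp_eq_exp_ℝ] at h2
  have h3 := h2.smul_const (coords g X)
  rw [← map_smul] at h3
  convert h3 using 2 with m
  rw [h1, map_smul, map_smul, smul_assoc]

end Exponential

/-! ### The parabolic subalgebra and its group -/

section Parabolic

open Module LieAlgebra NormedSpace Filter

variable {g : Type u} [LieRing g] [LieAlgebra ℝ g] {𝒜 : ℤ → Submodule ℝ g} {E : g}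

lemma mem_parabolic {p : ℤ} (hp : 0 ≤ p) {X : g} (hX : X ∈ 𝒜 p) : X ∈ parabolic 𝒜 :=
  Submodule.mem_iSup_of_mem p (Submodule.mem_iSup_of_mem hp hX)

lemma mem_parabolic_iff (hG : IsLieGrading 𝒜) {π : ℤ → g →ₗ[ℝ] g}
    (h2 : ∀ p q, q ≠ p → ∀ X ∈ 𝒜 q, π p X = 0)
    (h3 : ∀ X, (∀ p, π p X = 0) → X = 0) {X : g} :
    X ∈ parabolic 𝒜 ↔ ∀ q < 0, π q X = 0 := by
  have key : ∀ q < 0, parabolic 𝒜 ≤ LinearMap.ker (π q) := fun q hq =>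
    iSup₂_le fun p hp Y hY => h2 q p (by omega) Y hY
  refine ⟨fun hX q hq => key q hq hX, fun hX => ?_⟩
  have dec : ∃ Y ∈ parabolic 𝒜, ∀ q, 0 ≤ q → π q (X - Y) = 0 := by
    clear hX
    induction X using hG.induction with
    | mem p X hp =>
      by_cases h : 0 ≤ p
      · exact ⟨X, mem_parabolic h hp, by simp⟩
      · exact ⟨0, zero_mem _, fun q hq => by rw [sub_zero]; exact h2 q p (by omega) X hp⟩
    | add X X' hX hX' =>
      obtain ⟨Y, hY, hY'⟩ := hX
      obtain ⟨Z, hZ, hZ'⟩ := hX'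
      exact ⟨Y + Z, add_mem hY hZ, fun q hq => by
        rw [add_sub_add_comm, map_add, hY' q hq, hZ' q hq, add_zero]⟩
  obtain ⟨Y, hY, hY'⟩ := dec
  have : X - Y = 0 := h3 _ fun q => by
    rcases lt_or_ge q 0 with hq | hq
    · rw [map_sub, hX q hq, key q hq hY, sub_zero]
    · exact hY' q hq
  rwa [sub_eq_zero.1 this]

lemma lie_mem_parabolic (hG : IsLieGrading 𝒜) {X Y : g} (hX : X ∈ parabolic 𝒜)
    (hY : Y ∈ parabolic 𝒜) : ⁅X, Y⁆ ∈ parabolic 𝒜 := by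
  have h1 : ∀ p, 0 ≤ p → ∀ Z ∈ 𝒜 p, parabolic 𝒜 ≤ (parabolic 𝒜).comap (ad ℝ g Z) :=
    fun p hp Z hZ => iSup₂_le fun q hq W hW => mem_parabolic (add_nonneg hp hq) (hG.lie_mem hZ hW)
  have h2 : parabolic 𝒜 ≤ (parabolic 𝒜).comap (ad ℝ g Y) :=
    iSup₂_le fun p hp Z hZ => by
      change ⁅Y, Z⁆ ∈ parabolic 𝒜
      rw [← lie_skew]
      exact neg_mem (h1 p hp Z hZ hY)
  rw [← lie_skew]
  exact neg_mem (h2 hX)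

/-- The parabolic subalgebra is its own normalizer. -/
lemma mem_parabolic_of_forall_lie_mem (hG : IsLieGrading 𝒜) (hE : IsCharacteristicElement 𝒜 E)
    {X : g} (hX : ∀ Y ∈ parabolic 𝒜, ⁅X, Y⁆ ∈ parabolic 𝒜) : X ∈ parabolic 𝒜 := by
  obtain ⟨π, -, -, h2, h3⟩ := hG.exists_proj
  have key : ∀ q, ∀ Z, π q ⁅Z, E⁆ = -(q : ℝ) • π q Z := by
    intro q Z
    induction Z using hG.induction with
    | mem p Z hZ =>
      rw [← lie_skew, hE.2 p Z hZ, map_neg, map_smul]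
      by_cases h : p = q
      · rw [h, neg_smul]
      · simp [h2 q p h Z hZ]
    | add Z W hZ hW => rw [add_lie, map_add, map_add, hZ, hW, smul_add]
  rw [mem_parabolic_iff hG h2 h3]
  intro q hq
  -- Testing against `E ∈ 𝔭` suffices: `ad E` is invertible on every component of negative degree.
  have h4 := (mem_parabolic_iff hG h2 h3).1 (hX E (mem_parabolic le_rfl hE.1)) q hq
  rw [key] at h4
  refine (smul_eq_zero.1 h4).resolve_left ?_
  simpa using hq.ne

variable [Module.Finite ℝ g]

lemma expAd_mem_parabolicGroup {X : g} (hX : X ∈ parabolic 𝒜) : expAd X ∈ parabolicGroup 𝒜 :=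
  Subgroup.subset_closure ⟨X, hX, isExpAd_expAd X⟩

lemma parabolicGroup_apply_mem (hG : IsLieGrading 𝒜) {a : Int g} (ha : a ∈ parabolicGroup 𝒜) {Y : g}
    (hY : Y ∈ parabolic 𝒜) : (a : g ≃ₗ[ℝ] g) Y ∈ parabolic 𝒜 := by
  induction ha using Subgroup.closure_induction'' generalizing Y with
  | one => exact hY
  | mul x y hx hy ihx ihy => exact ihx (ihy hY)
  | mem x hx =>
    obtain ⟨X, hX, hx⟩ := hx
    rw [hx.eq_expAd]
    exact expAd_mem (fun Y hY => lie_mem_parabolic hG hX hY) hY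
  | inv_mem x hx =>
    obtain ⟨X, hX, hx⟩ := hx
    rw [hx.eq_expAd, ← expAd_neg]
    exact expAd_mem (fun Y hY => lie_mem_parabolic hG (neg_mem hX) hY) hY

lemma hasDerivAt_exp_adCoords {c : ℝ → Fin (finrank ℝ g) → ℝ} {c' : Fin (finrank ℝ g) → ℝ}
    (h0 : c 0 = 0) (hc : HasDerivAt c c' 0) :
    HasDerivAt (fun s => exp (adCoords g (c s))) (adCoords g c') 0 := by
  have h1 : HasDerivAt (fun s => adCoords g (c s)) (adCoords g c') 0 :=
    (adCoords g).hasFDerivAt.comp_hasDerivAt 0 hc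
  have h2 : HasFDerivAt (exp : ((Fin (finrank ℝ g) → ℝ) →L[ℝ] (Fin (finrank ℝ g) → ℝ)) → _)
      (1 : _ →L[ℝ] _) (adCoords g (c 0)) := by
    rw [h0, map_zero]
    exact hasFDerivAt_exp_zero
  exact h2.comp_hasDerivAt 0 h1

lemma _root_.HasDerivAt.mem_of_eventually_mem {V : Type*} [NormedAddCommGroup V] [NormedSpace ℝ V]
    {U : Submodule ℝ V} (hU : IsClosed (U : Set V)) {f : ℝ → V} {f' : V} {x : ℝ}
    (hf : HasDerivAt f f' x) (h : ∀ᶠ s in 𝓝 x, f s ∈ U) : f' ∈ U := by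
  refine hU.mem_of_tendsto (hasDerivAt_iff_tendsto_slope.1 hf) ?_
  filter_upwards [h.filter_mono nhdsWithin_le_nhds] with s hs
  exact U.smul_mem _ (U.sub_mem hs h.self_of_nhds)

/-- Two curves with the same image in the homogeneous space have the same derivative modulo the
isotropy algebra. -/
lemma sub_mem_parabolic_of_hasDerivAt (hG : IsLieGrading 𝒜) (hE : IsCharacteristicElement 𝒜 E)
    {x y : ℝ → g} {x' y' : g} (hx0 : x 0 = 0) (hy0 : y 0 = 0)
    (hx : HasDerivAt (fun s => coords g (x s)) (coords g x') 0)
    (hy : HasDerivAt (fun s => coords g (y s)) (coords g y') 0)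
    (h : ∀ᶠ s in 𝓝 (0 : ℝ), (expAd (x s))⁻¹ * expAd (y s) ∈ parabolicGroup 𝒜) :
    y' - x' ∈ parabolic 𝒜 := by
  -- `exp(-x) exp(y)` stays in the isotropy group, which preserves `𝔭`; differentiating its action
  -- on `Y ∈ 𝔭` gives `[y' - x', Y] ∈ 𝔭`. Since `𝔭` is its own normalizer, nothing about the
  -- topology of the isotropy group is needed.
  refine mem_parabolic_of_forall_lie_mem hG hE fun Y hY => ?_
  have hx2 : HasDerivAt (fun s => exp (adCoords g (-coords g (x s)))) (adCoords g (-coords g x')) 0 :=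
    hasDerivAt_exp_adCoords (by simp [hx0]) hx.neg
  have hy2 : HasDerivAt (fun s => exp (adCoords g (coords g (y s)))) (adCoords g (coords g y')) 0 :=
    hasDerivAt_exp_adCoords (by simp [hy0]) hy
  have h1 := (ContinuousLinearMap.apply ℝ _ (coords g Y)).hasFDerivAt.comp_hasDerivAt 0
    (hx2.mul hy2)
  have h2 := h1.mem_of_eventually_mem
    (U := (parabolic 𝒜).comap (coords g).symm.toLinearMap) (by exact isClosed_coords (parabolic 𝒜)) (by
      filter_upwards [h] with s hs
      have h3 := parabolicGroup_apply_mem hG hs hY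
      rw [← expAd_neg] at h3
      change (coords g).symm (exp (adCoords g (-coords g (x s)))
        (exp (adCoords g (coords g (y s))) (coords g Y))) ∈ parabolic 𝒜
      rw [← map_neg, ← coords_expAd, ← coords_expAd, LinearEquiv.symm_apply_apply]
      exact h3)
  have h4 : coords g ⁅y' - x', Y⁆ = (ContinuousLinearMap.apply ℝ _ (coords g Y))
      (adCoords g (-coords g x') * exp (adCoords g (coords g (y 0))) +
        exp (adCoords g (-coords g (x 0))) * adCoords g (coords g y')) := by
    rw [hx0, hy0, map_zero, neg_zero, map_zero, exp_zero, mul_one, one_mul, map_neg,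
      ← adCoords_apply, map_sub, map_sub, neg_add_eq_sub]
    rfl
  rw [← h4] at h2
  simpa using h2

end Parabolic

/-! ### CR automorphisms reversing the characteristic element -/

section Geometry

open Module LieAlgebra NormedSpace Filter

variable {n k : ℕ} {H : SesqForm n k} {g : Type u} [LieRing g] [LieAlgebra ℝ g]
  {𝒜 : ℤ → Submodule ℝ g} {E : g} {i₁ : (Fin n → ℂ) →ₗ[ℝ] g} {i₂ : (Fin k → ℝ) →ₗ[ℝ] g}
  {γ : Equiv.Perm (Quadric 𝒜)} {b : Int g}

lemma eq_zero_of_mem_parabolic (hG : IsLieGrading 𝒜) {p : ℤ} (hp : p < 0) {X : g} (hX : X ∈ 𝒜 p)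
    (hX' : X ∈ parabolic 𝒜) : X = 0 := by
  obtain ⟨π, -, h1, h2, h3⟩ := hG.exists_proj
  rw [← h1 p X hX]
  exact (mem_parabolic_iff hG h2 h3).1 hX' p hp

/-- The dilation of `ℂⁿ × ℝᵏ` induced by `exp(t ad E)`. -/
noncomputable def dilation (n k : ℕ) (t : ℝ) :
    (Fin n → ℂ) × (Fin k → ℝ) →L[ℝ] (Fin n → ℂ) × (Fin k → ℝ) :=
  (Real.exp (-t) • ContinuousLinearMap.id ℝ _).prodMap
    (Real.exp (-2 * t) • ContinuousLinearMap.id ℝ _)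

variable [Module.Finite ℝ g]

lemma mk_mul_expAd {a q : Int g} (hq : q ∈ parabolicGroup 𝒜) (X : g) :
    (QuotientGroup.mk (a * q * expAd X) : Quadric 𝒜) =
      QuotientGroup.mk (a * expAd ((q : g ≃ₗ[ℝ] g) X)) := by
  rw [QuotientGroup.eq, ← Int.mul_expAd_mul_inv]
  convert inv_mem hq using 1
  group

lemma expAd_smul_chart (hN : HasNonposPart H 𝒜 i₁ i₂) (hE : IsCharacteristicElement 𝒜 E) (t : ℝ)
    (v : (Fin n → ℂ) × (Fin k → ℝ)) :
    expAd (t • E) • chart 𝒜 i₁ i₂ 1 v = chart 𝒜 i₁ i₂ 1 (dilation n k t v) := by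
  have h1 : (expAd (t • E) : g ≃ₗ[ℝ] g) (i₁ v.1 + i₂ v.2) =
      i₁ (dilation n k t v).1 + i₂ (dilation n k t v).2 := by
    rw [map_add, expAd_smul_of_lie_eq (hE.2 _ _ (hN.i₁_mem v.1)),
      expAd_smul_of_lie_eq (hE.2 _ _ (hN.i₂_mem v.2))]
    simp [dilation, mul_comm]
  change QuotientGroup.mk (expAd (t • E) * (1 * _)) = _
  rw [chart, ← h1, ← mk_mul_expAd (expAd_mem_parabolicGroup
    (Submodule.smul_mem _ t (mem_parabolic le_rfl hE.1))), one_mul, one_mul]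

lemma expAd_mul (a : Int g) (X : g) :
    expAd X * a = a * expAd ((a⁻¹ : Int g).1 X) := by
  rw [← Int.mul_expAd_mul_inv]
  group

/-- `exp(tE)` fixes `o`, so `exp(-tE)` fixes `γ(o) = b · o`; conjugate by `b⁻¹`. -/
lemma expAd_mem_parabolicGroup_of_adEq (hE : IsCharacteristicElement 𝒜 E)
    (hγ : AdEq 𝒜 γ E (-E)) (hb : γ (QuotientGroup.mk 1) = QuotientGroup.mk b) (t : ℝ) :
    expAd (t • (b⁻¹ : Int g).1 (-E)) ∈ parabolicGroup 𝒜 := by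
  have h1 : expAd (t • E) • (QuotientGroup.mk 1 : Quadric 𝒜) = QuotientGroup.mk 1 := by
    change QuotientGroup.mk (expAd (t • E) * 1) = _
    rw [mul_one, eq_comm, QuotientGroup.eq, inv_one, one_mul]
    exact expAd_mem_parabolicGroup (Submodule.smul_mem _ t (mem_parabolic le_rfl hE.1))
  have h2 := hγ t (QuotientGroup.mk b)
  rw [← hb, Equiv.symm_apply_apply, h1, hb] at h2
  change _ = QuotientGroup.mk (expAd (t • -E) * b) at h2
  rw [expAd_mul, QuotientGroup.eq, inv_mul_cancel_left, map_smul] at h2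
  exact h2

/-- The map `v ↦ i₁ v₁ + i₂ v₂`, in coordinates. -/
noncomputable def coordsIncl (i₁ : (Fin n → ℂ) →ₗ[ℝ] g) (i₂ : (Fin k → ℝ) →ₗ[ℝ] g) :
    (Fin n → ℂ) × (Fin k → ℝ) →L[ℝ] (Fin (finrank ℝ g) → ℝ) :=
  LinearMap.toContinuousLinearMap ((coords g).toLinearMap ∘ₗ i₁.coprod i₂)

lemma hasDerivAt_coords {F : (Fin n → ℂ) × (Fin k → ℝ) → (Fin n → ℂ) × (Fin k → ℝ)}
    (hF : DifferentiableAt ℝ F 0) (v : (Fin n → ℂ) × (Fin k → ℝ)) :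
    HasDerivAt (fun s : ℝ => coords g (i₁ (F (s • v)).1 + i₂ (F (s • v)).2))
      (coords g (i₁ (fderiv ℝ F 0 v).1 + i₂ (fderiv ℝ F 0 v).2)) 0 := by
  have h1 : HasDerivAt (fun s : ℝ => s • v) v 0 := by
    simpa using (hasDerivAt_id (0 : ℝ)).smul_const v
  have h2 : HasFDerivAt F (fderiv ℝ F 0) ((0 : ℝ) • v) := by
    rw [zero_smul]
    exact hF.hasFDerivAt
  exact (coordsIncl i₁ i₂).hasFDerivAt.comp_hasDerivAt 0 (h2.comp_hasDerivAt 0 h1)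

lemma tendsto_smul_zero {V : Type*} [NormedAddCommGroup V] [NormedSpace ℝ V] (v : V) :
    Tendsto (fun s : ℝ => s • v) (𝓝 0) (𝓝 0) := by
  have : Continuous fun s : ℝ => s • v := by fun_prop
  simpa using this.tendsto 0

/-- The complex differential of a CR map with a CR left inverse is injective. -/
lemma injective_of_isCRMap_symm (hG : IsLieGrading 𝒜) (hN : HasNonposPart H 𝒜 i₁ i₂)
    (hE : IsCharacteristicElement 𝒜 E)
    (hγ : IsCRMap 𝒜 i₁ i₂ γ.symm) (hb : γ (QuotientGroup.mk 1) = QuotientGroup.mk b)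
    {F : (Fin n → ℂ) × (Fin k → ℝ) → (Fin n → ℂ) × (Fin k → ℝ)} (hF0 : F 0 = 0)
    (hF : DifferentiableAt ℝ F 0)
    (hγF : ∀ᶠ v in 𝓝 0, γ (chart 𝒜 i₁ i₂ 1 v) = chart 𝒜 i₁ i₂ b (F v))
    {L : (Fin n → ℂ) →ₗ[ℂ] (Fin n → ℂ)} (hL : ∀ z, fderiv ℝ F 0 (z, 0) = (L z, 0)) :
    Function.Injective L := by
  obtain ⟨F', hF'0, hF', hγF', -⟩ := hγ b 1 (by rw [← hb, Equiv.symm_apply_apply])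
  replace hF' := hF'.differentiableAt (by simp)
  rw [injective_iff_map_eq_zero]
  intro z hz
  have h1 : Tendsto F (𝓝 0) (𝓝 0) := by simpa [hF0] using hF.continuousAt.tendsto
  -- `F' ∘ F` is compared with the identity only through the chart. Equality of derivatives modulo
  -- `𝔭` is enough, so injectivity of the chart plays no role.
  have h2 : ∀ᶠ v in 𝓝 0, chart 𝒜 i₁ i₂ 1 v = chart 𝒜 i₁ i₂ 1 ((F' ∘ F) v) := by
    filter_upwards [hγF, h1.eventually hγF'] with v hv hv'
    rw [Function.comp_apply, ← hv', ← hv, Equiv.symm_apply_apply]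
  have h3 : HasFDerivAt (F' ∘ F) ((fderiv ℝ F' 0).comp (fderiv ℝ F 0)) 0 := by
    refine HasFDerivAt.comp 0 ?_ hF.hasFDerivAt
    rw [hF0]
    exact hF'.hasFDerivAt
  have h4 := sub_mem_parabolic_of_hasDerivAt hG hE
    (x := fun s => i₁ (s • (z, (0 : Fin k → ℝ))).1 + i₂ (s • (z, (0 : Fin k → ℝ))).2)
    (y := fun s => i₁ ((F' ∘ F) (s • (z, 0))).1 + i₂ ((F' ∘ F) (s • (z, 0))).2)
    (by simp) (by simp [hF0, hF'0]) (hasDerivAt_coords (F := id) differentiableAt_id (z, 0))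
    (hasDerivAt_coords h3.differentiableAt (z, 0)) (by
      filter_upwards [(tendsto_smul_zero (z, (0 : Fin k → ℝ))).eventually h2] with s hs
      rw [chart, chart, QuotientGroup.eq, one_mul, one_mul] at hs
      exact hs)
  rw [h3.fderiv, ContinuousLinearMap.comp_apply, hL, hz, Prod.mk_zero_zero, map_zero] at h4
  have h5 : i₁ z = 0 := eq_zero_of_mem_parabolic hG (by norm_num) (hN.i₁_mem z)
    (by simpa using neg_mem h4)
  exact hN.injective₁ (h5.trans (map_zero i₁).symm)

/-- A CR automorphism mapping `E` to `-E` conjugates the isotropy action of `exp(tE)` on the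
complex tangent space at the base point to that of `exp(-tE)` at the image point. -/
lemma expAd_sub_mem_parabolic (hG : IsLieGrading 𝒜) (hN : HasNonposPart H 𝒜 i₁ i₂)
    (hE : IsCharacteristicElement 𝒜 E) (hγ : IsCRAutomorphism 𝒜 i₁ i₂ γ)
    (hγE : AdEq 𝒜 γ E (-E)) (hb : γ (QuotientGroup.mk 1) = QuotientGroup.mk b) (t : ℝ)
    (z : Fin n → ℂ) :
    (expAd (t • (b⁻¹ : Int g).1 (-E)) : g ≃ₗ[ℝ] g) (i₁ z) - Real.exp (-t) • i₁ z ∈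
      parabolic 𝒜 := by
  obtain ⟨F, hF0, hF, hγF, L, hL⟩ := hγ.1 1 b hb
  replace hF := hF.differentiableAt (by simp)
  have hLs : Function.Surjective L := LinearMap.surjective_of_injective
    (injective_of_isCRMap_symm hG hN hE hγ.2 hb hF0 hF hγF hL)
  obtain ⟨z, rfl⟩ := hLs z
  set q := expAd (t • (b⁻¹ : Int g).1 (-E))
  have hq : q ∈ parabolicGroup 𝒜 := expAd_mem_parabolicGroup_of_adEq hE hγE hb t
  have h0 : Tendsto (dilation n k t) (𝓝 0) (𝓝 0) := by
    simpa using (dilation n k t).continuous.tendsto 0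
  -- Both sides are `γ ∘ exp(tE)` near `o`: on the left `exp(tE)` acts as a dilation before `γ`, on
  -- the right it is moved past `γ` and then past `b`.
  have h1 : ∀ᶠ v in 𝓝 0, chart 𝒜 i₁ i₂ b ((F ∘ dilation n k t) v) =
      QuotientGroup.mk (b * expAd ((q : g ≃ₗ[ℝ] g) (i₁ (F v).1 + i₂ (F v).2))) := by
    filter_upwards [hγF, h0.eventually hγF] with v hv hv'
    rw [Function.comp_apply, ← hv', ← expAd_smul_chart hN hE,
      ← γ.symm_apply_apply (chart 𝒜 i₁ i₂ 1 v), hγE t, hv, ← mk_mul_expAd hq]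
    change QuotientGroup.mk (expAd (t • -E) * (b * _)) = _
    rw [← mul_assoc, expAd_mul, map_smul]
  have h3 : HasFDerivAt (F ∘ dilation n k t) ((fderiv ℝ F 0).comp (dilation n k t)) 0 := by
    refine HasFDerivAt.comp 0 ?_ (dilation n k t).hasFDerivAt
    rw [map_zero]
    exact hF.hasFDerivAt
  have h4 : HasDerivAt (fun s : ℝ => coords g ((q : g ≃ₗ[ℝ] g)
      (i₁ (F (s • (z, 0))).1 + i₂ (F (s • (z, 0))).2)))
      (coords g ((q : g ≃ₗ[ℝ] g)
        (i₁ (fderiv ℝ F 0 (z, 0)).1 + i₂ (fderiv ℝ F 0 (z, 0)).2))) 0 := by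
    simp only [q, coords_expAd]
    exact (exp _ : _ →L[ℝ] _).hasFDerivAt.comp_hasDerivAt 0 (hasDerivAt_coords hF (z, 0))
  have h5 := sub_mem_parabolic_of_hasDerivAt hG hE
    (x := fun s => i₁ ((F ∘ dilation n k t) (s • (z, 0))).1 +
      i₂ ((F ∘ dilation n k t) (s • (z, 0))).2)
    (by simp [hF0]) (by simp [hF0]) (hasDerivAt_coords h3.differentiableAt (z, 0)) h4 (by
      filter_upwards [(tendsto_smul_zero (z, (0 : Fin k → ℝ))).eventually h1] with s hs
      rw [chart, QuotientGroup.eq, mul_inv_rev, mul_assoc, inv_mul_cancel_left] at hs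
      exact hs)
  have h6 : dilation n k t (z, 0) = Real.exp (-t) • (z, 0) := by simp [dilation]
  rw [h3.fderiv, ContinuousLinearMap.comp_apply, h6, map_smul, hL] at h5
  simpa using h5

lemma lie_sub_mem_parabolic (hG : IsLieGrading 𝒜) (hN : HasNonposPart H 𝒜 i₁ i₂)
    (hE : IsCharacteristicElement 𝒜 E) (hγ : IsCRAutomorphism 𝒜 i₁ i₂ γ)
    (hγE : AdEq 𝒜 γ E (-E)) (hb : γ (QuotientGroup.mk 1) = QuotientGroup.mk b)
    (z : Fin n → ℂ) : ⁅(b⁻¹ : Int g).1 (-E), i₁ z⁆ + i₁ z ∈ parabolic 𝒜 := by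
  have h1 : HasDerivAt (fun t : ℝ => exp (adCoords g (coords g (t • (b⁻¹ : Int g).1 (-E)))))
      (adCoords g (coords g ((b⁻¹ : Int g).1 (-E)))) 0 :=
    hasDerivAt_exp_adCoords (by simp) (by
      simpa using (hasDerivAt_id (0 : ℝ)).smul_const (coords g ((b⁻¹ : Int g).1 (-E))))
  have h2 := (ContinuousLinearMap.apply ℝ _ (coords g (i₁ z))).hasFDerivAt.comp_hasDerivAt 0 h1
  have h3 : HasDerivAt (fun t : ℝ => Real.exp (-t) • coords g (i₁ z)) (-coords g (i₁ z)) 0 := by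
    simpa using ((hasDerivAt_id (0 : ℝ)).neg.exp).smul_const (coords g (i₁ z))
  have h4 := (h2.sub h3).mem_of_eventually_mem
    (U := (parabolic 𝒜).comap (coords g).symm.toLinearMap)
    (by exact isClosed_coords (parabolic 𝒜)) (.of_forall fun t => by
      have h5 := expAd_sub_mem_parabolic hG hN hE hγ hγE hb t z
      rw [← (coords g).symm_apply_apply (_ - _), map_sub, coords_expAd,
        map_smul (coords g) (Real.exp (-t))] at h5
      exact h5)
  rw [sub_neg_eq_add, ContinuousLinearMap.apply_apply, adCoords_apply, ← map_add,
    Submodule.mem_comap, LinearEquiv.coe_coe, LinearEquiv.symm_apply_apply] at h4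
  exact h4

/-- `Ad(b⁻¹)(-E)` is congruent to `E` modulo `[𝔤, 𝔤]` by its isotropy action on `𝔤₋₁`, and to `-E`
because it is an `Int(𝔤)`-translate of `-E`. -/
lemma mem_derivedSeries_of_adEq (hG : IsLieGrading 𝒜) (hN : HasNonposPart H 𝒜 i₁ i₂)
    (hT : IsTransitive 𝒜)
    (hE : IsCharacteristicElement 𝒜 E) (hγ : IsCRAutomorphism 𝒜 i₁ i₂ γ)
    (hγE : AdEq 𝒜 γ E (-E)) : E ∈ derivedSeries ℝ g 1 := by
  obtain ⟨b, hb⟩ := QuotientGroup.mk_surjective (γ (QuotientGroup.mk 1))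
  set X := (b⁻¹ : Int g).1 (-E)
  obtain ⟨π, hπ, h1, h2, h3⟩ := hG.exists_proj
  -- Modulo `𝔭`, positive degree parts of `X` may still contribute to `[X, Z]` in degree `≥ 0`;
  -- projecting to degree `-1` isolates the degree zero part.
  have h4 : ∀ Y : g, ∀ Z ∈ 𝒜 (-1), π (-1) ⁅Y, Z⁆ = ⁅π 0 Y, Z⁆ := by
    intro Y Z hZ
    induction Y using hG.induction with
    | mem p Y hY =>
      by_cases hp : p = 0
      · subst hp
        rw [h1 0 Y hY, h1 (-1) _ (hG.lie_mem' hY hZ)]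
      · rw [h2 0 p hp Y hY, zero_lie, h2 (-1) (p + -1) (by omega) _ (hG.lie_mem hY hZ)]
    | add Y Y' hY hY' => rw [add_lie, map_add, map_add, hY, hY', add_lie]
  have h5 : π 0 X - E = 0 := by
    by_contra h
    obtain ⟨Y, hY, hY'⟩ := hT 0 le_rfl _ (sub_mem (hπ 0 X) hE.1) h
    apply hY'
    obtain ⟨z, rfl⟩ := hN.exists_eq_i₁ hY
    have h6 := (mem_parabolic_iff hG h2 h3).1
      (lie_sub_mem_parabolic hG hN hE hγ hγE hb.symm z) (-1) (by norm_num)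
    rw [map_add, h4 _ _ hY, h1 _ _ hY] at h6
    rw [sub_lie, hE.2 _ _ hY, Int.cast_neg, Int.cast_one, neg_one_smul, sub_neg_eq_add]
    exact h6
  have h6 : ∀ Y : g, Y - π 0 Y ∈ derivedSeries ℝ g 1 := by
    intro Y
    induction Y using hG.induction with
    | mem p Y hY =>
      by_cases hp : p = 0
      · subst hp
        simp [h1 0 Y hY]
      · have h7 : ⁅E, Y⁆ ∈ derivedSeries ℝ g 1 :=
          LieSubmodule.lie_mem_lie (LieSubmodule.mem_top E) (LieSubmodule.mem_top Y)
        rw [hE.2 p Y hY] at h7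
        rw [h2 0 p hp Y hY, sub_zero]
        simpa [hp] using (derivedSeries ℝ g 1).smul_mem (p : ℝ)⁻¹ h7
    | add Y Y' hY hY' => rw [map_add, add_sub_add_comm]; exact add_mem hY hY'
  have h7 := h6 X
  rw [sub_eq_zero.1 h5] at h7
  have h8 := sub_mem (Int.sub_mem_derivedSeries b⁻¹ (-E)) h7
  have h9 : X - -E - (X - E) = (2 : ℝ) • E := by rw [two_smul]; abel
  change X - -E - (X - E) ∈ _ at h8
  rw [h9] at h8
  simpa using (derivedSeries ℝ g 1).smul_mem (2 : ℝ)⁻¹ h8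

end Geometry

end CRQuadric

theorem mainTheorem7 {n k : ℕ} (H : CRQuadric.SesqForm n k)
    (hherm : CRQuadric.IsHermitianForm H) (hnondeg : CRQuadric.IsNondegenerate H)
    (hfund : CRQuadric.IsFundamental H)
    {g : Type u} [LieRing g] [LieAlgebra ℝ g] (𝒜 : ℤ → Submodule ℝ g)
    (i₁ : (Fin n → ℂ) →ₗ[ℝ] g) (i₂ : (Fin k → ℝ) →ₗ[ℝ] g)
    (hLT : CRQuadric.IsLeviTanaka H 𝒜 i₁ i₂)
    (E : g) (hE : CRQuadric.IsCharacteristicElement 𝒜 E)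
    (s : LieSubalgebra ℝ g) (hs : CRQuadric.IsPseudocomplexGradedLevi 𝒜 i₁ s)
    (hγ : ∃ γ : Equiv.Perm (CRQuadric.Quadric 𝒜),
      CRQuadric.IsCRAutomorphism 𝒜 i₁ i₂ γ ∧ CRQuadric.AdEq 𝒜 γ E (-E)) :
    E ∈ s ∧ ∀ Es ∈ s, ∀ Er ∈ LieAlgebra.radical ℝ g, E = Es + Er → E = Es := by
  have := hLT.nonpos.finite hLT.grading hLT.transitive hherm hnondeg hfund
  obtain ⟨γ, hγ, hγE⟩ := hγ
  have hder := CRQuadric.mem_derivedSeries_of_adEq hLT.grading hLT.nonpos hLT.transitive hE hγ hγE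
  have key : ∀ Es ∈ s, ∀ Er ∈ LieAlgebra.radical ℝ g, E = Es + Er → E = Es := by
    intro Es hEs Er hEr h
    rw [CRQuadric.radical_component_eq_zero hLT.grading hLT.transitive hE hs hder hEs hEr h,
      add_zero] at h
    exact h
  refine ⟨?_, key⟩
  obtain ⟨Es, hEs, Er, hEr, h⟩ := Submodule.mem_sup.1
    (hs.isCompl.sup_eq_top ▸ Submodule.mem_top :
      E ∈ s.toSubmodule ⊔ (LieAlgebra.radical ℝ g).toSubmodule)
  rw [key Es hEs Er hEr h.symm]
  exact hEs
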